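/- For a closed Riemann surface $M$ with a compatible smooth Riemannian metric $g=\rho^2\,dz\,d\bar z$, let $\mathcal Q(M)$ be the complex vector space of smooth quadratic differentials (tensors $\Psi=\psi\,dz^2$ with $\psi$ smooth in each complex coordinate $z$), let $P_g$ be the $L^2(M,g)$-orthogonal projection of $\mathcal Q(M)$ onto the holomorphic quadratic differentials, and let $\bar\partial\Psi=\partial_{\bar z}\psi\,d\bar z\otimes dz^2$. The $L^1$ and $L^2$ norms are those of $(M,g)$, with $|dz^2|_g=2\rho^{-2}$ and $|d\bar z\otimes dz^2|_g=2\sqrt2\,\rho^{-3}$. A flat unit-area torus $(T^2,g)$ is such a surface that is homeomorphic to the torus, where $g$ has Gauss curvature $0$ and area $1$. For $a\in\mathbb R$ and $b>0$ let $\Gamma_{a,b}=\{nb+m(a+\tfrac ib): n,m\in\mathbb Z\}$, a lattice of covolume $1$, and for a smooth $\Gamma_{a,b}$-periodic function $\phi:\mathbb C\to\mathbb C$ let $\bar\phi$ be its mean value over a period cell. (1) For each flat unit-area torus $(T^2,g)$ the projection $P_g$ is well defined and there exists $C<\infty$ such that $$\|\Psi-P_g(\Psi)\|_{L^1(T^2,g)}\le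 C\,\|\bar\partial\Psi\|_{L^1(T^2,g)}\quad\text{for every }\Psi\in\mathcal Q(T^2).\qquad(*)$$ (2) The estimate is not uniform: given any $C<\infty$ there exists a flat unit-area torus $(T^2,g)$ for which $(*)$ is violated. (3) If $(T^2,g)$ is isometric, by a map preserving the complex structures, to $\mathbb C/\Gamma_{a,b}$ with the Euclidean metric, then for every $C<\infty$ the estimate $(*)$ holds with the constant $C$ if and only if $$\|\phi-\bar\phi\|_{L^1(\mathbb C/\Gamma_{a,b})}\le \sqrt2\,C\,\|\partial_{\bar z}\phi\|_{L^1(\mathbb C/\Gamma_{a,b})}\quad\text{for every smooth }\Gamma_{a,b}\text{-periodic }\phi.$$ (4) For all $a\in\mathbb R$ and $b>0$ there exists $C<\infty$ such that $\|\phi-\bar\phi\|_{L^1(\mathbb C/\Gamma_{a,b})}\le C\,\|\partial_{\bar z}\phi\|_{L^1(\mathbb C/\Gamma_{a,b})}$ for every smooth $\Gamma_{a,b}$-periodic $\phi$. (5) For every $C<\infty$ and all sufficiently large $b$, the smooth $\Gamma_{0,b}$-periodic function $\phi(x+iy)=\sin(\tfrac{2\pi}{b}x)$ violates $\|\phi-\bar\phi\|_{L^1(\mathbb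 C/\Gamma_{0,b})}\le C\,\|\partial_{\bar z}\phi\|_{L^1(\mathbb C/\Gamma_{0,b})}$. -/

import Mathlib

open MeasureTheory Filter
open scoped Manifold ContDiff NNReal ENNReal Laplacian

noncomputable section

/-- The Wirtinger derivative `∂f/∂z̄ = (∂f/∂x + i ∂f/∂y) / 2`. -/
def dbarDeriv (f : ℂ → ℂ) (w : ℂ) : ℂ :=
  (1 / 2) * (fderiv ℝ f w 1 + Complex.I * fderiv ℝ f w Complex.I)

section RiemannSurface

variable (M : Type*) [TopologicalSpace M] [ChartedSpace ℂ M]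

/-- A smooth Riemannian metric compatible with the complex structure of `M`. In the complex
coordinate `z` given by a chart `e` it reads `ρ_e² dz dz̄` with a smooth positive conformal factor
`ρ_e`; only the values of `ρ_e` on `e.target` matter. -/
structure ConformalMetric where
  rho : atlas ℂ M → ℂ → ℝ
  smooth : ∀ e, ContDiffOn ℝ ∞ (rho e) e.1.target
  pos : ∀ e, ∀ w ∈ e.1.target, 0 < rho e w
  transform : ∀ e e' : atlas ℂ M, ∀ w ∈ e.1.target, e.1.symm w ∈ e'.1.source →
    rho e w = rho e' (e'.1 (e.1.symm w)) * ‖deriv (e'.1 ∘ e.1.symm) w‖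

/-- The complex vector space of smooth quadratic differentials: tensors that read `ψ_e dz²` in the
complex coordinate `z` given by a chart `e`, with `ψ_e` smooth on `e.target`. The coefficient `ψ_e`
is extended by `0` outside `e.target`, so that equality of tensors is equality of coefficients. -/
def QuadDiff : Submodule ℂ (atlas ℂ M → ℂ → ℂ) where
  carrier := {ψ |
    (∀ e, ContDiffOn ℝ ∞ (ψ e) e.1.target) ∧
    (∀ e, ∀ w ∉ e.1.target, ψ e w = 0) ∧
    ∀ e e' : atlas ℂ M, ∀ w ∈ e.1.target, e.1.symm w ∈ e'.1.source →
      ψ e w = ψ e' (e'.1 (e.1.symm w)) * deriv (e'.1 ∘ e.1.symm) w ^ 2}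
  add_mem' := by
    rintro φ ψ ⟨h1, h2, h3⟩ ⟨k1, k2, k3⟩
    refine ⟨fun e => (h1 e).add (k1 e), fun e w hw => ?_, fun e e' w hw hs => ?_⟩
    · simp [h2 e w hw, k2 e w hw]
    · simp only [Pi.add_apply]
      rw [h3 e e' w hw hs, k3 e e' w hw hs]
      ring
  zero_mem' := ⟨fun _ => contDiffOn_const, fun _ _ _ => rfl, fun _ _ _ _ _ => by simp⟩
  smul_mem' := by
    rintro c ψ ⟨h1, h2, h3⟩
    refine ⟨fun e => (h1 e).const_smul c, fun e w hw => ?_, fun e e' w hw hs => ?_⟩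
    · simp [h2 e w hw]
    · simp only [Pi.smul_apply, smul_eq_mul]
      rw [h3 e e' w hw hs]
      ring

variable {M}

/-- A quadratic differential is holomorphic if it is represented in each complex chart by a
holomorphic function. -/
def IsHolomorphicQD (Ψ : QuadDiff M) : Prop :=
  ∀ e, DifferentiableOn ℂ (Ψ.1 e) e.1.target

/-- The preferred chart at a point, as an element of the atlas. The pointwise quantities below are
evaluated in it; by the transformation laws every other chart at the point gives the same value. -/
def preferredChart (x : M) : atlas ℂ M := ⟨chartAt ℂ x, chart_mem_atlas ℂ x⟩

namespace ConformalMetric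

variable (g : ConformalMetric M)

/-- The Gauss curvature `K = -ρ⁻² Δ log ρ` of `ρ² dz dz̄`, in the coordinate of the chart `e`. -/
def gaussCurvature (e : atlas ℂ M) (w : ℂ) : ℝ :=
  -((g.rho e w ^ 2)⁻¹ * (Δ fun v => Real.log (g.rho e v)) w)

def IsFlat : Prop := ∀ e : atlas ℂ M, ∀ w ∈ e.1.target, g.gaussCurvature e w = 0

/-- The area form `ρ² dx dy` of one chart, carried to `M`: the part of the area measure that lives
on the domain of the chart. -/
def chartArea [MeasurableSpace M] (e : atlas ℂ M) : Measure M :=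
  ((volume.restrict e.1.target).withDensity
    fun w => ENNReal.ofReal (g.rho e w ^ 2)).map e.1.symm

/-- The Riemannian area measure `dv_g`. The measures `chartArea e` agree on the overlaps of chart
domains, and `dv_g` is the least measure that dominates all of them. -/
def area [MeasurableSpace M] : Measure M := ⨆ e : atlas ℂ M, g.chartArea e

/-- The pointwise norm `|ψ dz²|_g = 2 ρ⁻² |ψ|`. -/
def qdNorm (Ψ : QuadDiff M) (x : M) : ℝ :=
  2 * (g.rho (preferredChart x) (chartAt ℂ x x) ^ 2)⁻¹ *
    ‖Ψ.1 (preferredChart x) (chartAt ℂ x x)‖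

/-- The pointwise norm of `∂̄Ψ = (∂ψ/∂z̄) dz̄ ⊗ dz²`, where `|dz̄ ⊗ dz²|_g = 2 √2 ρ⁻³`. -/
def dbarNorm (Ψ : QuadDiff M) (x : M) : ℝ :=
  2 * Real.sqrt 2 * (g.rho (preferredChart x) (chartAt ℂ x x) ^ 3)⁻¹ *
    ‖dbarDeriv (Ψ.1 (preferredChart x)) (chartAt ℂ x x)‖

/-- The pointwise Hermitian product `⟨φ dz², ψ dz²⟩_g = 4 ρ⁻⁴ φ ψ̄`. -/
def qdInner (Φ Ψ : QuadDiff M) (x : M) : ℂ :=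
  4 * (((g.rho (preferredChart x) (chartAt ℂ x x) ^ 4)⁻¹ : ℝ) : ℂ) *
    (Φ.1 (preferredChart x) (chartAt ℂ x x) *
      (starRingEnd ℂ) (Ψ.1 (preferredChart x) (chartAt ℂ x x)))

variable [MeasurableSpace M]

/-- The norm `‖Ψ‖_{L¹(M,g)}`. -/
def l1Norm (Ψ : QuadDiff M) : ℝ≥0∞ := ∫⁻ x, ENNReal.ofReal (g.qdNorm Ψ x) ∂g.area

/-- The norm `‖∂̄Ψ‖_{L¹(M,g)}`. -/
def l1NormDbar (Ψ : QuadDiff M) : ℝ≥0∞ := ∫⁻ x, ENNReal.ofReal (g.dbarNorm Ψ x) ∂g.area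

/-- The inner product `⟨Φ, Ψ⟩_{L²(M,g)}`. -/
def l2Inner (Φ Ψ : QuadDiff M) : ℂ := ∫ x, g.qdInner Φ Ψ x ∂g.area

/-- `Φ = P_g(Ψ)`: `Φ` is the `L²(M,g)`-orthogonal projection of `Ψ` onto the space of holomorphic
quadratic differentials. -/
def IsHolomorphicPart (Ψ Φ : QuadDiff M) : Prop :=
  IsHolomorphicQD Φ ∧ ∀ Θ : QuadDiff M, IsHolomorphicQD Θ → g.l2Inner (Ψ - Φ) Θ = 0

/-- The estimate `‖Ψ - P_g(Ψ)‖_{L¹} ≤ C ‖∂̄Ψ‖_{L¹}` for every smooth quadratic differential. -/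
def PoincareEstimate (C : ℝ≥0) : Prop :=
  ∀ Ψ Φ : QuadDiff M, g.IsHolomorphicPart Ψ Φ → g.l1Norm (Ψ - Φ) ≤ C * g.l1NormDbar Ψ

/-- `(M, g)` is a flat torus of unit area. -/
structure IsFlatUnitTorus : Prop where
  torus : Nonempty (M ≃ₜ Circle × Circle)
  flat : g.IsFlat
  unit_area : g.area Set.univ = 1

end ConformalMetric

end RiemannSurface

section Lattice

/-- The lattice `Γ_{a,b} = {n b + m (a + i/b) : n, m ∈ ℤ}`. -/
def torusLattice (a b : ℝ) : Set ℂ :=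
  {w | ∃ n m : ℤ, w = n * (b : ℂ) + m * ((a : ℂ) + Complex.I / b)}

/-- The fundamental parallelogram of `Γ_{a,b}`, which has area `1`. -/
def torusCell (a b : ℝ) : Set ℂ :=
  {w | ∃ s ∈ Set.Ico (0 : ℝ) 1, ∃ t ∈ Set.Ico (0 : ℝ) 1,
    w = s * (b : ℂ) + t * ((a : ℂ) + Complex.I / b)}

/-- Smooth `Γ_{a,b}`-periodic functions. -/
def IsSmoothPeriodic (a b : ℝ) (φ : ℂ → ℂ) : Prop :=
  ContDiff ℝ ∞ φ ∧ ∀ z, ∀ w ∈ torusLattice a b, φ (z + w) = φ z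

/-- The inequality `‖φ - φ̄‖_{L¹(ℂ/Γ)} ≤ C ‖∂φ/∂z̄‖_{L¹(ℂ/Γ)}` for one function `φ`, where `Γ` is
`Γ_{a,b}` and `φ̄` is the mean value of `φ`. -/
def LatticeBound (a b : ℝ) (φ : ℂ → ℂ) (C : ℝ≥0) : Prop :=
  ∫⁻ z in torusCell a b, ‖φ z - ⨍ w in torusCell a b, φ w‖ₑ ≤
    C * ∫⁻ z in torusCell a b, ‖dbarDeriv φ z‖ₑ

/-- `π : ℂ → M` induces an isometry from `ℂ / Γ_{a,b}` with the Euclidean metric onto `(M, g)` that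
preserves the complex structures. -/
structure IsLatticePresentation {M : Type*} [TopologicalSpace M] [ChartedSpace ℂ M]
    (g : ConformalMetric M) (a b : ℝ) (π : ℂ → M) : Prop where
  surjective : Function.Surjective π
  fiber : ∀ z w, π z = π w ↔ z - w ∈ torusLattice a b
  holomorphic : MDifferentiable 𝓘(ℂ) 𝓘(ℂ) π
  isometric : ∀ (e : atlas ℂ M) (z : ℂ), π z ∈ e.1.source →
    g.rho e (e.1 (π z)) * ‖deriv (e.1 ∘ π) z‖ = 1

end Lattice

end

open scoped Topology

/-! ### The Wirtinger derivative -/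

/-! The estimate on a fixed flat torus is a compactness argument carried out on the surface itself,
without uniformization. Zero curvature says that `log ρ` is harmonic, so in a small disc `ρ⁻²` is
the modulus of a holomorphic function and the norm of a holomorphic quadratic differential is twice
the modulus of a holomorphic function. By the maximum principle this norm is constant on a compact
connected surface (`IsFlat.exists_qdNorm_eq_const`). Hence the holomorphic differentials form a
space of dimension at most one and the projection is given by the usual formula with one generator.

If no constant worked, there would be `u n`, orthogonal to the holomorphic differentials, with `L¹`
norm one and `∂̄` tending to zero in `L¹`. In a disc, the Cauchy–Pompeiu formula for a cut-off
coefficient splits it into a holomorphic part with sup and Lipschitz bounds, and an error bounded in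
`L¹` by `∂̄`, because `1/w` is locally integrable (`exists_holomorphic_approx`). Along an
ultrafilter the holomorphic parts converge uniformly on a smaller disc (`exists_holomorphic_limit`).
The local limits agree on overlaps and glue to a holomorphic `Φ` with `u n → Φ` in `L¹`
(`exists_holomorphic_l1_limit`). Since `Φ` has bounded norm, orthogonality passes to the limit and
gives `⟨Φ, Φ⟩ = 0`, so `Φ = 0`, against the normalization.

On `ℂ / Γ` the covering map turns a differential into a periodic function, the holomorphic ones into
constants (Liouville) and the projection into the mean value. The norms `|dz²| = 2` and `|dz̄ ⊗ dz²|
= 2√2` account for the factor `√2` (`poincareEstimate_iff`). The bound for each lattice then follows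
from the estimate on an explicit torus. Conversely, `sin (2πx/b)` has `L¹` norm at least `1/2` while
its `∂̄` is at most `π/b`, which rules out a constant common to all lattices, hence to all flat
tori. -/

theorem ContinuousLinearMap.apply_eq_re_im (A : ℂ →L[ℝ] ℂ) (v : ℂ) :
    A v = v.re * A 1 + v.im * A Complex.I := by
  have hv : v = v.re • (1 : ℂ) + v.im • Complex.I := by simp [Complex.re_add_im]
  have h := congrArg A hv
  rwa [map_add, map_smul, map_smul, Complex.real_smul, Complex.real_smul] at h

/-- Writing `A v = α v + β v̄`, the left side is `2 β v̄`: the combination isolates the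
conjugate-linear part. Both the chain rule for `∂̄` and its polar form rest on this. -/
theorem ContinuousLinearMap.apply_add_I_mul_apply (A : ℂ →L[ℝ] ℂ) (v : ℂ) :
    A v + Complex.I * A (v * Complex.I) = (starRingEnd ℂ) v * (A 1 + Complex.I * A Complex.I) := by
  rw [A.apply_eq_re_im v, A.apply_eq_re_im (v * Complex.I)]
  have h : (starRingEnd ℂ) v = v.re - v.im * Complex.I := by
    apply Complex.ext <;> simp
  rw [h]
  simp only [Complex.mul_re, Complex.I_re, mul_zero, Complex.I_im, mul_one, zero_sub,
    Complex.mul_im, add_zero]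
  push_cast
  linear_combination (v.im : ℂ) * A Complex.I * Complex.I_mul_I

/-- Holomorphic `F` contributes only the conjugate of its derivative, and `∂̄k = 0`. With `F` a
coordinate change and `k` the square of its derivative this is the tensor law for `∂̄Ψ`. -/
theorem dbarDeriv_comp_mul {f F k : ℂ → ℂ} {z : ℂ} (hf : DifferentiableAt ℝ f (F z))
    (hF : DifferentiableAt ℂ F z) (hk : DifferentiableAt ℂ k z) :
    dbarDeriv (fun w => f (F w) * k w) z =
      dbarDeriv f (F z) * (starRingEnd ℂ) (deriv F z) * k z := by
  have h1 : HasFDerivAt F ((ContinuousLinearMap.toSpanSingleton ℂ (deriv F z)).restrictScalars ℝ)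
    z :=
    hF.hasDerivAt.hasFDerivAt.restrictScalars ℝ
  have h2 : HasFDerivAt k ((ContinuousLinearMap.toSpanSingleton ℂ (deriv k z)).restrictScalars ℝ)
    z :=
    hk.hasDerivAt.hasFDerivAt.restrictScalars ℝ
  have h3 := (hf.hasFDerivAt.comp z h1).mul h2
  have h4 : fderiv ℝ (fun w => f (F w) * k w) z = _ := h3.fderiv
  unfold dbarDeriv
  rw [h4]
  have := (fderiv ℝ f (F z)).apply_add_I_mul_apply (deriv F z)
  simp only [Function.comp_apply, add_apply, smul_apply,
    ContinuousLinearMap.coe_restrictScalars', ContinuousLinearMap.toSpanSingleton_apply,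
    smul_eq_mul, one_mul, ContinuousLinearMap.comp_apply]
  rw [mul_comm Complex.I (deriv F z)]
  linear_combination (1 / 2) * k z * this + (1 / 2) * f (F z) * deriv k z * Complex.I_mul_I

theorem dbarDeriv_eq_zero {f : ℂ → ℂ} {z : ℂ} (hf : DifferentiableAt ℂ f z) :
    dbarDeriv f z = 0 := by
  have h1 : HasFDerivAt f ((ContinuousLinearMap.toSpanSingleton ℂ (deriv f z)).restrictScalars ℝ)
    z :=
    hf.hasDerivAt.hasFDerivAt.restrictScalars ℝ
  rw [dbarDeriv, h1.fderiv]
  simp only [ContinuousLinearMap.coe_restrictScalars', ContinuousLinearMap.toSpanSingleton_apply,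
    smul_eq_mul, one_mul]
  linear_combination (1 / 2) * deriv f z * Complex.I_mul_I

theorem dbarDeriv_mul {f g : ℂ → ℂ} {z : ℂ} (hf : DifferentiableAt ℝ f z)
    (hg : DifferentiableAt ℝ g z) :
    dbarDeriv (fun w => f w * g w) z = f z * dbarDeriv g z + g z * dbarDeriv f z := by
  have h4 : fderiv ℝ (fun w => f w * g w) z = _ := (hf.hasFDerivAt.mul hg.hasFDerivAt).fderiv
  unfold dbarDeriv
  rw [h4]
  simp only [add_apply, smul_apply, smul_eq_mul]
  ring

theorem dbarDeriv_sub {f g : ℂ → ℂ} {z : ℂ} (hf : DifferentiableAt ℝ f z)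
    (hg : DifferentiableAt ℝ g z) :
    dbarDeriv (f - g) z = dbarDeriv f z - dbarDeriv g z := by
  unfold dbarDeriv
  rw [fderiv_sub hf hg]
  simp only [sub_apply]
  ring

theorem dbarDeriv_const_smul (c : ℂ) {f : ℂ → ℂ} {z : ℂ} (hf : DifferentiableAt ℝ f z) :
    dbarDeriv (c • f) z = c * dbarDeriv f z := by
  unfold dbarDeriv
  rw [fderiv_const_smul hf]
  simp only [smul_apply, smul_eq_mul]
  ring

theorem Filter.EventuallyEq.dbarDeriv_eq {f g : ℂ → ℂ} {z : ℂ} (h : f =ᶠ[𝓝 z] g) :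
    dbarDeriv f z = dbarDeriv g z := by
  rw [dbarDeriv, dbarDeriv, h.fderiv_eq]

theorem ContDiffOn.continuousOn_dbarDeriv {f : ℂ → ℂ} {U : Set ℂ} (hU : IsOpen U)
    (hf : ContDiffOn ℝ ∞ f U) : ContinuousOn (dbarDeriv f) U := by
  have h := hf.continuousOn_fderiv_of_isOpen hU (by simp)
  unfold dbarDeriv
  fun_prop

/-! ### The Cauchy–Pompeiu formula -/

/-- In polar coordinates the Jacobian `r` cancels the singularity and the integrand becomes `(∂_r u
+ (i/r) ∂_θ u) / 2`. On each ray the radial term integrates to `-u 0`; on each circle the angular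
term integrates to zero. -/
theorem integral_dbarDeriv_div_self {u : ℂ → ℂ} (hu : ContDiff ℝ 1 u) (hc : HasCompactSupport u) :
    ∫ w, dbarDeriv u w / w = -Real.pi * u 0 := by
  have hdc : Continuous (fderiv ℝ u) := hu.continuous_fderiv (by simp)
  obtain ⟨R, hR⟩ : ∃ R : ℝ, ∀ w, R < ‖w‖ → u w = 0 ∧ fderiv ℝ u w = 0 := by
    obtain ⟨R, hR⟩ := hc.isCompact.isBounded.exists_norm_le
    refine ⟨R, fun w hw => ?_⟩
    have : w ∉ tsupport u := fun h => absurd (hR w h) (not_le.mpr hw)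
    exact ⟨image_eq_zero_of_notMem_tsupport this,
      image_eq_zero_of_notMem_tsupport fun h => this (tsupport_fderiv_subset ℝ h)⟩
  let P : ℝ → ℝ → ℂ := fun r θ => r * Complex.exp (θ * Complex.I)
  have hP : Continuous fun p : ℝ × ℝ => P p.1 p.2 := by fun_prop
  have hPn : ∀ r θ, ‖P r θ‖ = |r| := fun r θ => by
    simp [P, Complex.norm_exp_ofReal_mul_I]
  let G1 : ℝ × ℝ → ℂ := fun p => fderiv ℝ u (P p.1 p.2) (Complex.exp (p.2 * Complex.I))
  let G2 : ℝ × ℝ → ℂ :=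
    fun p => fderiv ℝ u (P p.1 p.2) (Complex.exp (p.2 * Complex.I) * Complex.I)
  have hG1 : Continuous G1 := (hdc.comp hP).clm_apply (by fun_prop)
  have hG2 : Continuous G2 := (hdc.comp hP).clm_apply (by fun_prop)
  have hint : ∀ G : ℝ × ℝ → ℂ, Continuous G → (∀ p : ℝ × ℝ, R < |p.1| → G p = 0) →
      IntegrableOn G (Set.Ioi 0 ×ˢ Set.Ioo (-Real.pi) Real.pi) := by
    intro G hG h0
    have hK : IsCompact (Set.Icc 0 R ×ˢ Set.Icc (-Real.pi) Real.pi) :=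
      isCompact_Icc.prod isCompact_Icc
    refine (hG.continuousOn.integrableOn_compact hK).of_forall_sdiff_eq_zero
      (measurableSet_Ioi.prod measurableSet_Ioo) ?_
    rintro ⟨r, θ⟩ ⟨⟨h1, h2⟩, h3⟩
    apply h0
    by_contra hcon
    exact h3 ⟨⟨le_of_lt h1, (le_abs_self r).trans (not_lt.mp hcon)⟩, ⟨h2.1.le, h2.2.le⟩⟩
  have hz : ∀ p : ℝ × ℝ, R < |p.1| → fderiv ℝ u (P p.1 p.2) = 0 :=
    fun p hp => (hR _ (by rwa [hPn])).2
  have hI1 := hint G1 hG1 fun p hp => by simp [G1, hz p hp]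
  have hI2 := hint G2 hG2 fun p hp => by simp [G2, hz p hp]
  have hPr : ∀ r θ : ℝ, HasDerivAt (fun r => P r θ) (Complex.exp (θ * Complex.I)) r := by
    intro r θ
    simpa using (Complex.ofRealCLM.hasDerivAt (x := r)).mul_const (Complex.exp (θ * Complex.I))
  have hPθ : ∀ r θ : ℝ, HasDerivAt (fun θ => P r θ)
      (r * (Complex.exp (θ * Complex.I) * Complex.I)) θ := by
    intro r θ
    have := ((Complex.ofRealCLM.hasDerivAt (x := θ)).mul_const Complex.I).cexp.const_mul (r : ℂ)
    simpa using this
  have hud : ∀ w, HasFDerivAt u (fderiv ℝ u w) w :=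
    fun w => (hu.differentiable (by simp) w).hasFDerivAt
  have e1 : ∫ p in Set.Ioi 0 ×ˢ Set.Ioo (-Real.pi) Real.pi, G1 p = -(2 * Real.pi) * u 0 := by
    rw [Measure.volume_eq_prod, ← setIntegral_prod_swap, setIntegral_prod]
    · have : ∀ θ : ℝ, ∫ r in Set.Ioi (0 : ℝ), G1 (r, θ) = - u 0 := by
        intro θ
        have hd : ∀ r ∈ Set.Ici (0 : ℝ), HasDerivAt (fun r => u (P r θ)) (G1 (r, θ)) r :=
          fun r _ => (hud _).comp_hasDerivAt r (hPr r θ)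
        have hz' : ∀ r ∈ Set.Ioi (0 : ℝ) \ Set.Icc 0 R, G1 (r, θ) = 0 := by
          rintro r ⟨h1, h2⟩
          have : R < |r| := by
            by_contra hcon
            exact h2 ⟨le_of_lt h1, (le_abs_self r).trans (not_lt.mp hcon)⟩
          simp [G1, hz (r, θ) this]
        have hi : IntegrableOn (fun r => G1 (r, θ)) (Set.Ioi 0) := by
          refine (Continuous.continuousOn (by fun_prop) |>.integrableOn_compact
            (isCompact_Icc (a := 0) (b := R))).of_forall_sdiff_eq_zero measurableSet_Ioi hz'
        have ht : Tendsto (fun r => u (P r θ)) atTop (𝓝 0) := by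
          refine tendsto_const_nhds.congr' ?_
          filter_upwards [eventually_gt_atTop R] with r hr
          exact (hR _ (by rw [hPn]; exact hr.trans_le (le_abs_self r))).1.symm
        rw [integral_Ioi_of_hasDerivAt_of_tendsto' hd hi ht]
        simp [P]
      simp only [Prod.swap, this]
      rw [setIntegral_const]
      simp [Measure.real, Real.volume_Ioo, ENNReal.toReal_ofReal
        (by positivity : 0 ≤ Real.pi + Real.pi)]
      exact Or.inl (by ring)
    · exact hI1.swap
  have e2 : ∫ p in Set.Ioi 0 ×ˢ Set.Ioo (-Real.pi) Real.pi, G2 p = 0 := by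
    rw [Measure.volume_eq_prod, setIntegral_prod _ hI2]
    refine setIntegral_eq_zero_of_forall_eq_zero fun r hr => ?_
    have hr0 : (r : ℂ) ≠ 0 := by exact_mod_cast (ne_of_gt hr)
    -- `G2` is `r⁻¹ ∂_θ u`, so `r * G2` is an exact derivative along the circle; the factor `r ≠ 0`
    -- is cancelled at the end.
    have hd : ∀ θ ∈ Set.uIcc (-Real.pi) Real.pi,
        HasDerivAt (fun θ => u (P r θ)) ((r : ℂ) * G2 (r, θ)) θ := by
      intro θ _
      have := (hud _).comp_hasDerivAt θ (hPθ r θ)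
      rw [← Complex.real_smul, map_smul, Complex.real_smul] at this
      exact this
    have h := intervalIntegral.integral_eq_sub_of_hasDerivAt hd
      ((by fun_prop : Continuous _).intervalIntegrable _ _)
    have hpi : P r Real.pi = P r (-Real.pi) := by
      simp [P, Complex.exp_pi_mul_I, Complex.exp_neg]
    rw [hpi, sub_self, intervalIntegral.integral_const_mul] at h
    rw [← integral_Ioc_eq_integral_Ioo, ← intervalIntegral.integral_of_le
      (by linarith [Real.pi_pos])]
    exact (mul_eq_zero.mp h).resolve_left hr0
  rw [← Complex.integral_comp_polarCoord_symm, show polarCoord.target = Set.Ioi (0 : ℝ) ×ˢ Set.Ioo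
    (-Real.pi) Real.pi from rfl]
  have : ∀ p ∈ Set.Ioi (0 : ℝ) ×ˢ Set.Ioo (-Real.pi) Real.pi,
      p.1 • (dbarDeriv u (Complex.polarCoord.symm p) / Complex.polarCoord.symm p) =
        (1 / 2) * (G1 p + Complex.I * G2 p) := by
    rintro ⟨r, θ⟩ ⟨hr, -⟩
    have hr0 : (r : ℂ) ≠ 0 := by exact_mod_cast (ne_of_gt hr)
    have hp : Complex.polarCoord.symm (r, θ) = P r θ := by
      simp [P, Complex.polarCoord_symm_apply, Complex.exp_mul_I]
    rw [hp]
    -- For `v = exp (iθ)` the conjugate of `v` is `exp (-iθ)`, which is `r / w`.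
    have hA := (fderiv ℝ u (P r θ)).apply_add_I_mul_apply (Complex.exp (θ * Complex.I))
    simp only [G1, G2, hA, dbarDeriv]
    rw [← Complex.exp_conj]
    simp only [map_mul, Complex.conj_ofReal, Complex.conj_I, P, Complex.real_smul]
    rw [mul_neg, Complex.exp_neg]
    have := Complex.exp_ne_zero (θ * Complex.I)
    field_simp
  rw [setIntegral_congr_fun (measurableSet_Ioi.prod measurableSet_Ioo) this, integral_const_mul,
    integral_add hI1 (hI2.const_mul _), integral_const_mul, e1, e2]
  ring

theorem eq_integral_dbarDeriv_div_sub {u : ℂ → ℂ} (hu : ContDiff ℝ 1 u) (hc : HasCompactSupport u)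
    (z : ℂ) : u z = -(Real.pi : ℂ)⁻¹ * ∫ w, dbarDeriv u w / (w - z) := by
  have h1 := integral_dbarDeriv_div_self (u := fun w => u (w + z)) (by fun_prop)
    (hc.comp_homeomorph (Homeomorph.addRight z))
  have h2 : ∀ w, dbarDeriv (fun w => u (w + z)) w = dbarDeriv u (w + z) := by
    intro w
    rw [dbarDeriv, dbarDeriv, fderiv_comp_add_right]
  simp only [h2, zero_add] at h1
  rw [← integral_add_right_eq_self _ z]
  simp only [add_sub_cancel_right]
  rw [h1]
  have : (Real.pi : ℂ) ≠ 0 := by exact_mod_cast Real.pi_ne_zero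
  field_simp

/-! ### Holomorphic approximation with an `L¹` error controlled by `∂̄` -/

/-- In polar coordinates the Jacobian `r` cancels `1/r`, leaving at most the area of a bounded
rectangle. -/
theorem lintegral_ball_inv_lt_top (R : ℝ) :
    ∫⁻ w in Metric.ball (0 : ℂ) R, ‖w⁻¹‖ₑ < ⊤ := by
  rw [← lintegral_indicator Metric.isOpen_ball.measurableSet, ←
    Complex.lintegral_comp_polarCoord_symm,
    show polarCoord.target = Set.Ioi (0 : ℝ) ×ˢ Set.Ioo (-Real.pi) Real.pi from rfl]
  calc _ ≤ ∫⁻ p in Set.Ioi (0 : ℝ) ×ˢ Set.Ioo (-Real.pi) Real.pi,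
        (Set.Ioo (0 : ℝ) R ×ˢ Set.Ioo (-Real.pi) Real.pi).indicator 1 p := by
        refine setLIntegral_mono' (measurableSet_Ioi.prod measurableSet_Ioo) ?_
        rintro ⟨r, θ⟩ ⟨hr, hθ⟩
        have hr' : (0 : ℝ) < r := hr
        have hn : ‖Complex.polarCoord.symm (r, θ)‖ = r := by
          rw [Complex.norm_polarCoord_symm, abs_of_pos hr']
        by_cases hR : r < R
        · rw [Set.indicator_of_mem (mem_ball_zero_iff.mpr (hn.trans_lt hR)),
            Set.indicator_of_mem (Set.mk_mem_prod (show r ∈ Set.Ioo 0 R from ⟨hr, hR⟩) hθ), ←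
              ofReal_norm, norm_inv, hn,
            smul_eq_mul, ← ENNReal.ofReal_mul hr'.le, mul_inv_cancel₀ hr'.ne']
          simp
        · rw [Set.indicator_of_notMem (by rwa [mem_ball_zero_iff, hn])]
          simp
    _ ≤ volume (Set.Ioo (0 : ℝ) R ×ˢ Set.Ioo (-Real.pi) Real.pi) := by
        rw [← lintegral_indicator_one (measurableSet_Ioo.prod measurableSet_Ioo)]
        exact setLIntegral_le_lintegral _ _
    _ < ⊤ := by
        rw [Measure.volume_eq_prod, Measure.prod_prod]
        exact ENNReal.mul_lt_top measure_Ioo_lt_top measure_Ioo_lt_top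

theorem lintegral_ball_inv_sub (R : ℝ) (z : ℂ) :
    ∫⁻ w in Metric.ball z R, ‖(w - z)⁻¹‖ₑ = ∫⁻ w in Metric.ball (0 : ℂ) R, ‖w⁻¹‖ₑ := by
  rw [← lintegral_indicator Metric.isOpen_ball.measurableSet,
    ← lintegral_indicator Metric.isOpen_ball.measurableSet, ← lintegral_add_right_eq_self _ z]
  congr 1 with w
  by_cases hw : w ∈ Metric.ball (0 : ℂ) R
  · rw [Set.indicator_of_mem hw, Set.indicator_of_mem (by simpa using hw), add_sub_cancel_right]
  · rw [Set.indicator_of_notMem hw, Set.indicator_of_notMem (by simpa using hw)]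

theorem integrableOn_inv_sub {K : Set ℂ} (hK : Bornology.IsBounded K) (z : ℂ) :
    IntegrableOn (fun w => (w - z)⁻¹) K := by
  obtain ⟨R, hR⟩ := hK.subset_ball z
  refine IntegrableOn.mono_set ?_ hR
  refine ⟨by fun_prop, ?_⟩
  rw [HasFiniteIntegral, lintegral_ball_inv_sub]
  exact lintegral_ball_inv_lt_top R

theorem integrable_mul_inv_sub {f : ℂ → ℂ} {K : Set ℂ} (hK : IsCompact K) (hf : ContinuousOn f K)
    (h0 : ∀ w ∉ K, f w = 0) (z : ℂ) : Integrable fun w => f w * (w - z)⁻¹ := by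
  rw [← integrableOn_iff_integrable_of_support_subset (s := K)]
  · exact (integrableOn_inv_sub hK.isBounded z).continuousOn_mul hf hK
  · intro w hw
    by_contra hcon
    simp [h0 w hcon] at hw

theorem integrable_of_continuousOn_compact {f : ℂ → ℂ} {K : Set ℂ} (hK : IsCompact K)
    (hf : ContinuousOn f K) (h0 : ∀ w ∉ K, f w = 0) : Integrable f := by
  rw [← integrableOn_iff_integrable_of_support_subset (s := K)]
  · exact hf.integrableOn_compact hK
  · intro w hw
    by_contra hcon
    exact hw (h0 w hcon)

/-- Integration against the Cauchy kernel gives a holomorphic function away from the support of the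
density. -/
theorem differentiableOn_cauchyTransform {f : ℂ → ℂ} (hf : Integrable f) {c : ℂ} {r d : ℝ}
    (hd : 0 < d) (h0 : ∀ w ∈ Metric.ball c (r + d), f w = 0) :
    DifferentiableOn ℂ (fun z => ∫ w, f w * (w - z)⁻¹) (Metric.ball c r) := by
  intro z hz
  have hfar : ∀ w, f w ≠ 0 → ∀ y ∈ Metric.ball c r, d ≤ ‖w - y‖ := by
    intro w hw y hy
    by_contra! hcon
    apply hw (h0 w _)
    rw [Metric.mem_ball] at hy ⊢
    calc dist w c ≤ dist w y + dist y c := dist_triangle _ _ _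
      _ < r + d := by rw [dist_eq_norm]; linarith
  have hb : ∀ w, ∀ y ∈ Metric.ball c r, ‖f w * ((w - y) ^ 2)⁻¹‖ ≤ ‖f w‖ * (d ^ 2)⁻¹ := by
    intro w y hy
    by_cases hw : f w = 0
    · simp [hw]
    rw [norm_mul, norm_inv, norm_pow]
    gcongr
    exact hfar w hw y hy
  have hmeas : ∀ y, AEStronglyMeasurable (fun w => f w * (w - y)⁻¹) volume := fun y =>
    hf.1.mul (Measurable.aestronglyMeasurable (by fun_prop))
  have := hasDerivAt_integral_of_dominated_loc_of_deriv_le (μ := volume) (𝕜 := ℂ)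
    (F := fun z w => f w * (w - z)⁻¹) (F' := fun z w => f w * ((w - z) ^ 2)⁻¹) (x₀ := z)
    (s := Metric.ball c r) (bound := fun w => ‖f w‖ * (d ^ 2)⁻¹)
    (Metric.isOpen_ball.mem_nhds hz) (Eventually.of_forall hmeas) ?_ ?_
    (Eventually.of_forall hb) (hf.norm.mul_const _) (Eventually.of_forall fun w y hy => ?_)
  · exact this.2.differentiableAt.differentiableWithinAt
  · refine (hf.norm.mul_const d⁻¹).mono' (hmeas z) (Eventually.of_forall fun w => ?_)
    by_cases hw : f w = 0
    · simp [hw]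
    rw [norm_mul, norm_inv]
    gcongr
    exact hfar w hw z hz
  · exact hf.1.mul (Measurable.aestronglyMeasurable (by fun_prop))
  · by_cases hw : f w = 0
    · simpa [hw] using hasDerivAt_const y (0 : ℂ)
    have hne : w - y ≠ 0 := by
      rw [← norm_pos_iff]
      exact hd.trans_le (hfar w hw y hy)
    have h := ((hasDerivAt_id y).const_sub w).inv hne
    simpa using h.const_mul (f w)

theorem enorm_le_ofReal {E : Type*} [SeminormedAddGroup E] {x : E} {r : ℝ} (h : ‖x‖ ≤ r) :
    ‖x‖ₑ ≤ ENNReal.ofReal r := by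
  rw [← ofReal_norm]
  exact ENNReal.ofReal_le_ofReal h

/-- For a cutoff `χ` the Cauchy–Pompeiu density is `∂̄(χψ) = χ ∂̄ψ + ψ ∂̄χ`. The second term lives
at distance at least `R/4` from the small disc, so its Cauchy transform `h` is holomorphic there,
with sup and Lipschitz bounds by the `L¹` norm of `ψ`. The transform of the first term is the error,
estimated by Fubini. The Lipschitz bound supplies equicontinuity for the compactness argument. -/
theorem exists_holomorphic_approx (c : ℂ) {R : ℝ} (hR : 0 < R) :
    ∃ K : ℝ≥0, ∀ ψ : ℂ → ℂ, ContDiffOn ℝ ∞ ψ (Metric.ball c R) →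
      ∃ h : ℂ → ℂ, DifferentiableOn ℂ h (Metric.ball c (R / 4)) ∧
        ∫⁻ z in Metric.ball c (R / 4), ‖ψ z - h z‖ₑ ≤
          K * ∫⁻ z in Metric.ball c R, ‖dbarDeriv ψ z‖ₑ ∧
        (∀ z ∈ Metric.ball c (R / 4), ‖h z‖ₑ ≤ K * ∫⁻ z in Metric.ball c R, ‖ψ z‖ₑ) ∧
        ∀ z ∈ Metric.ball c (R / 4), ∀ y ∈ Metric.ball c (R / 4),
          ‖h z - h y‖ₑ ≤ K * (∫⁻ z in Metric.ball c R, ‖ψ z‖ₑ) * ‖z - y‖ₑ := by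
  let χ : ContDiffBump c := ⟨R / 2, 3 * R / 4, by positivity, by linarith⟩
  let X : ℂ → ℂ := fun w => (χ w : ℂ)
  have hX : ContDiff ℝ ∞ X := Complex.ofRealCLM.contDiff.comp χ.contDiff
  have hXd : Differentiable ℝ X := hX.differentiable (by simp)
  set B := Metric.closedBall c (3 * R / 4) with hBdef
  have hB : IsCompact B := isCompact_closedBall _ _
  have hBR : B ⊆ Metric.ball c R := Metric.closedBall_subset_ball (by linarith)
  have hX0 : ∀ w ∉ B, X =ᶠ[𝓝 w] 0 := by
    intro w hw
    filter_upwards [Metric.isClosed_closedBall.isOpen_compl.mem_nhds hw] with y hy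
    have : χ y = 0 := χ.zero_of_le_dist (le_of_lt (by simpa [hBdef] using hy))
    simp [X, this]
  have hXB : ∀ w ∉ B, X w = 0 := fun w hw => (hX0 w hw).self_of_nhds
  have hdX0 : ∀ w ∉ B, dbarDeriv X w = 0 := fun w hw => by
    rw [(hX0 w hw).dbarDeriv_eq]
    simp [dbarDeriv]
  have hdXc : Continuous (dbarDeriv X) := by
    rw [← continuousOn_univ]
    exact hX.contDiffOn.continuousOn_dbarDeriv isOpen_univ
  have hX1 : ∀ w ∈ Metric.ball c (R / 2), X w = 1 := fun w hw => by
    simp [X, χ.one_of_mem_closedBall (Metric.ball_subset_closedBall hw)]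
  have hdX1 : ∀ w ∈ Metric.ball c (R / 2), dbarDeriv X w = 0 := fun w hw => by
    have : X =ᶠ[𝓝 w] fun _ => 1 := by
      filter_upwards [Metric.isOpen_ball.mem_nhds hw] with y hy using hX1 y hy
    rw [this.dbarDeriv_eq]
    simp [dbarDeriv]
  obtain ⟨A, hA⟩ := hB.exists_bound_of_continuousOn hdXc.continuousOn
  have hA0 : 0 ≤ A := (norm_nonneg _).trans (hA c (Metric.mem_closedBall_self (by positivity)))
  have hXn : ∀ w, ‖X w‖ ≤ 1 := fun w => by
    simp only [X, Complex.norm_real, Real.norm_eq_abs, abs_of_nonneg χ.nonneg]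
    exact χ.le_one
  -- Points of the support of `χ` and of the small disc are less than `R` apart, so radius `2R`
  -- covers every difference `w - z`.
  set I := ∫⁻ w in Metric.ball (0 : ℂ) (2 * R), ‖w⁻¹‖ₑ with hI
  have hItop : I < ⊤ := lintegral_ball_inv_lt_top _
  have hpi : ‖(Real.pi : ℂ)⁻¹‖ ≤ 1 := by
    rw [norm_inv, Complex.norm_real, Real.norm_eq_abs, abs_of_pos Real.pi_pos]
    exact inv_le_one_of_one_le₀ (by linarith [Real.pi_gt_three])
  -- `I` serves the `L¹` error, `A * (4/R)` the sup bound and `A * (4/R)²` the Lipschitz bound: `A`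
  -- bounds `∂̄χ`, `4/R` bounds the kernel, and a difference of two kernels carries their product.
  -- The factor `1/π` is bounded by one.
  refine ⟨max I.toNNReal (max (A * (4 / R)).toNNReal (A * (4 / R) ^ 2).toNNReal), fun ψ hψ => ?_⟩
  let f1 : ℂ → ℂ := fun w => X w * dbarDeriv ψ w
  let f2 : ℂ → ℂ := fun w => ψ w * dbarDeriv X w
  let u : ℂ → ℂ := fun w => X w * ψ w
  have hψd : ∀ w ∈ Metric.ball c R, ContDiffAt ℝ ∞ ψ w :=
    fun w hw => hψ.contDiffAt (Metric.isOpen_ball.mem_nhds hw)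
  have hu0 : ∀ w ∉ B, u =ᶠ[𝓝 w] 0 := fun w hw => by
    filter_upwards [hX0 w hw] with y hy
    simp [u, hy]
  have hu : ContDiff ℝ 1 u := by
    rw [contDiff_iff_contDiffAt]
    intro w
    by_cases hw : w ∈ B
    · exact (hX.contDiffAt.mul (hψd w (hBR hw))).of_le (by simp)
    · exact contDiffAt_const.congr_of_eventuallyEq (hu0 w hw)
  have huc : HasCompactSupport u := HasCompactSupport.intro hB fun w hw => (hu0 w hw).self_of_nhds
  have hdu : ∀ w, dbarDeriv u w = f1 w + f2 w := by
    intro w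
    by_cases hw : w ∈ B
    · exact dbarDeriv_mul (hXd w) ((hψd w (hBR hw)).differentiableAt (by simp))
    · have h0 : dbarDeriv (0 : ℂ → ℂ) w = 0 := by simp [dbarDeriv]
      rw [(hu0 w hw).dbarDeriv_eq, h0]
      simp [f1, f2, hXB w hw, hdX0 w hw]
  have hf10 : ∀ w ∉ B, f1 w = 0 := fun w hw => by simp [f1, hXB w hw]
  have hf20 : ∀ w ∉ B, f2 w = 0 := fun w hw => by simp [f2, hdX0 w hw]
  have hf1c : ContinuousOn f1 B :=
    hX.continuous.continuousOn.mul ((hψ.continuousOn_dbarDeriv Metric.isOpen_ball).mono hBR)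
  have hf2c : ContinuousOn f2 B := (hψ.continuousOn.mono hBR).mul hdXc.continuousOn
  have hf1i := integrable_of_continuousOn_compact hB hf1c hf10
  have hf2i := integrable_of_continuousOn_compact hB hf2c hf20
  have hf2near : ∀ w ∈ Metric.ball c (R / 4 + R / 4), f2 w = 0 := fun w hw => by
    simp [f2, hdX1 w (by convert hw using 2; ring)]
  have hfar : ∀ w, f2 w ≠ 0 → ∀ y ∈ Metric.ball c (R / 4), R / 4 ≤ ‖w - y‖ := by
    intro w hw y hy
    by_contra! hcon
    apply hw (hf2near w _)
    rw [Metric.mem_ball] at hy ⊢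
    calc dist w c ≤ dist w y + dist y c := dist_triangle _ _ _
      _ < R / 4 + R / 4 := by rw [dist_eq_norm]; linarith
  have hf2n : ∫⁻ w, ‖f2 w‖ₑ ≤ ENNReal.ofReal A * ∫⁻ w in Metric.ball c R, ‖ψ w‖ₑ := by
    rw [← lintegral_const_mul' _ _ ENNReal.ofReal_ne_top,
      ← lintegral_indicator Metric.isOpen_ball.measurableSet]
    refine lintegral_mono fun w => ?_
    by_cases hw : w ∈ B
    · rw [Set.indicator_of_mem (hBR hw)]
      simp only [f2, enorm_mul]
      rw [mul_comm]
      gcongr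
      exact enorm_le_ofReal (hA w hw)
    · simp [hf20 w hw]
  have hR4 : (R / 4)⁻¹ = 4 / R := by rw [inv_div]
  refine ⟨fun z => -(Real.pi : ℂ)⁻¹ * ∫ w, f2 w * (w - z)⁻¹,
    (differentiableOn_cauchyTransform hf2i (by positivity) hf2near).const_mul _, ?_, ?_, ?_⟩
  · have key : ∀ z ∈ Metric.ball c (R / 4), ψ z - -(Real.pi : ℂ)⁻¹ * ∫ w, f2 w * (w - z)⁻¹ =
        -(Real.pi : ℂ)⁻¹ * ∫ w, f1 w * (w - z)⁻¹ := by
      intro z hz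
      have h1 := eq_integral_dbarDeriv_div_sub hu huc z
      simp only [hdu, div_eq_mul_inv, add_mul] at h1
      rw [integral_add (integrable_mul_inv_sub hB hf1c hf10 z)
        (integrable_mul_inv_sub hB hf2c hf20 z)] at h1
      have h2 : u z = ψ z := by
        simp [u, hX1 z (Metric.ball_subset_ball (by linarith) hz)]
      rw [← h2, h1]
      ring
    calc _ ≤ ∫⁻ z in Metric.ball c (R / 4), ∫⁻ w, ‖f1 w‖ₑ * ‖(w - z)⁻¹‖ₑ := by
          refine setLIntegral_mono' Metric.isOpen_ball.measurableSet fun z hz => ?_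
          rw [key z hz, enorm_mul, enorm_neg]
          calc _ ≤ 1 * ∫⁻ w, ‖f1 w * (w - z)⁻¹‖ₑ := by
                gcongr
                · simpa using enorm_le_ofReal hpi
                · exact enorm_integral_le_lintegral_enorm _
            _ = _ := by simp only [one_mul, enorm_mul]
      _ = ∫⁻ w, ∫⁻ z in Metric.ball c (R / 4), ‖f1 w‖ₑ * ‖(w - z)⁻¹‖ₑ := by
          rw [lintegral_lintegral_swap]
          have hm : Measurable fun p : ℂ × ℂ => ‖(p.2 - p.1)⁻¹‖ₑ := by fun_prop
          exact hf1i.1.enorm.comp_snd.mul hm.aemeasurable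
      _ ≤ ∫⁻ w, (Metric.ball c R).indicator (fun w => I * ‖dbarDeriv ψ w‖ₑ) w := by
          refine lintegral_mono fun w => ?_
          by_cases hw : w ∈ B
          · rw [Set.indicator_of_mem (hBR hw), lintegral_const_mul' _ _ enorm_ne_top, mul_comm]
            gcongr
            · rw [hI, ← lintegral_ball_inv_sub (2 * R) w]
              calc _ = ∫⁻ z in Metric.ball c (R / 4), ‖(z - w)⁻¹‖ₑ := by
                    congr 1 with z
                    rw [← neg_sub, inv_neg, enorm_neg]
                _ ≤ _ := lintegral_mono_set (Metric.ball_subset_ball' (by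
                    have : dist w c ≤ 3 * R / 4 := hw
                    rw [dist_comm]
                    linarith))
            · simp only [f1, enorm_mul]
              calc _ ≤ 1 * ‖dbarDeriv ψ w‖ₑ := by
                    gcongr
                    simpa using enorm_le_ofReal (hXn w)
                _ = _ := one_mul _
          · simp [hf10 w hw]
      _ = I * ∫⁻ w in Metric.ball c R, ‖dbarDeriv ψ w‖ₑ := by
          rw [lintegral_indicator Metric.isOpen_ball.measurableSet,
            lintegral_const_mul' _ _ hItop.ne]
      _ ≤ _ := by
          gcongr
          exact (ENNReal.coe_toNNReal hItop.ne).symm.le.trans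
            (ENNReal.coe_le_coe.mpr (le_max_left _ _))
  · intro z hz
    rw [enorm_mul, enorm_neg]
    calc _ ≤ 1 * ∫⁻ w, ENNReal.ofReal (4 / R) * ‖f2 w‖ₑ := by
          gcongr
          · simpa using enorm_le_ofReal hpi
          · refine (enorm_integral_le_lintegral_enorm _).trans (lintegral_mono fun w => ?_)
            by_cases hw : f2 w = 0
            · simp [hw]
            rw [enorm_mul, mul_comm]
            gcongr
            apply enorm_le_ofReal
            rw [norm_inv, ← hR4]
            gcongr
            exact hfar w hw z hz
      _ ≤ ENNReal.ofReal (4 / R) * (ENNReal.ofReal A * ∫⁻ w in Metric.ball c R, ‖ψ w‖ₑ) := by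
          rw [one_mul, lintegral_const_mul' _ _ ENNReal.ofReal_ne_top]
          gcongr
      _ ≤ _ := by
          rw [← mul_assoc, mul_comm (ENNReal.ofReal (4 / R)), ← ENNReal.ofReal_mul hA0]
          gcongr
          exact ENNReal.coe_le_coe.mpr (le_max_of_le_right (le_max_left _ _))
  · intro z hz y hy
    rw [← mul_sub, ← integral_sub (integrable_mul_inv_sub hB hf2c hf20 z)
      (integrable_mul_inv_sub hB hf2c hf20 y), enorm_mul, enorm_neg]
    calc _ ≤ 1 * ∫⁻ w, ENNReal.ofReal ((4 / R) ^ 2) * ‖z - y‖ₑ * ‖f2 w‖ₑ := by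
          gcongr
          · simpa using enorm_le_ofReal hpi
          · refine (enorm_integral_le_lintegral_enorm _).trans (lintegral_mono fun w => ?_)
            by_cases hw : f2 w = 0
            · simp [hw]
            have hz' := hfar w hw z hz
            have hy' := hfar w hw y hy
            have hR4' : 0 < R / 4 := by positivity
            have e : f2 w * (w - z)⁻¹ - f2 w * (w - y)⁻¹ =
                ((w - z)⁻¹ * (w - y)⁻¹) * (z - y) * f2 w := by
              have h1 : w - z ≠ 0 := norm_pos_iff.mp (hR4'.trans_le hz')
              have h2 : w - y ≠ 0 := norm_pos_iff.mp (hR4'.trans_le hy')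
              field_simp
              ring
            rw [e, enorm_mul, enorm_mul]
            gcongr
            apply enorm_le_ofReal
            rw [norm_mul, norm_inv, norm_inv, ← hR4, sq]
            gcongr
      _ ≤ ENNReal.ofReal ((4 / R) ^ 2) * ‖z - y‖ₑ *
          (ENNReal.ofReal A * ∫⁻ w in Metric.ball c R, ‖ψ w‖ₑ) := by
          rw [one_mul, lintegral_const_mul' _ _ (ENNReal.mul_ne_top ENNReal.ofReal_ne_top
            enorm_ne_top)]
          gcongr
      _ = ENNReal.ofReal (A * (4 / R) ^ 2) * (∫⁻ w in Metric.ball c R, ‖ψ w‖ₑ) * ‖z - y‖ₑ := by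
          rw [ENNReal.ofReal_mul hA0]
          ring
      _ ≤ _ := by
          gcongr
          exact ENNReal.coe_le_coe.mpr (le_max_of_le_right (le_max_right _ _))

/-! ### Change of variables -/

/-- Multiplication by `F' z`, as a real linear map of the plane, has determinant `|F' z|²`. -/
theorem lintegral_image_holomorphic {F : ℂ → ℂ} {S : Set ℂ} (hS : MeasurableSet S)
    (hF : ∀ z ∈ S, DifferentiableAt ℂ F z) (hinj : Set.InjOn F S) (f : ℂ → ℝ≥0∞) :
    ∫⁻ w in F '' S, f w = ∫⁻ z in S, ENNReal.ofReal (‖deriv F z‖ ^ 2) * f (F z) := by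
  rw [lintegral_image_eq_lintegral_abs_det_fderiv_mul volume hS
    (fun z hz => ((hF z hz).hasDerivAt.hasFDerivAt.restrictScalars ℝ).hasFDerivWithinAt) hinj]
  congr 1 with z
  congr 2
  simp [ContinuousLinearMap.det, LinearMap.det_restrictScalars, Algebra.norm_complex_eq,
    Complex.normSq_eq_norm_sq]

theorem ContinuousOn.measurableSet_inter_preimage {X Y : Type*} [TopologicalSpace X]
    [MeasurableSpace X] [OpensMeasurableSpace X] [TopologicalSpace Y] [MeasurableSpace Y]
    [BorelSpace Y] {f : X → Y} {U : Set X} (hf : ContinuousOn f U) (hU : IsOpen U) {A : Set Y}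
    (hA : MeasurableSet A) : MeasurableSet (U ∩ f ⁻¹' A) := by
  have h := (continuousOn_iff_continuous_domRestrict.1 hf).measurable hA
  rw [← Subtype.image_preimage_coe]
  exact hU.measurableSet.subtype_image h

section RiemannSurface

variable {M : Type*} [TopologicalSpace M] [ChartedSpace ℂ M]

/-! ### Transition maps and the transformation laws -/

namespace ConformalMetric

variable (g : ConformalMetric M)

/-- Positivity of the conformal factor in its transformation law excludes a zero derivative. As
`deriv` is `0` where a function is not differentiable, this also makes the transition maps
holomorphic. -/
theorem deriv_transition_ne_zero (g : ConformalMetric M) (e e' : atlas ℂ M) {w : ℂ}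
    (hw : w ∈ e.1.target)
    (hs : e.1.symm w ∈ e'.1.source) : deriv (e'.1 ∘ e.1.symm) w ≠ 0 := by
  intro h
  have h1 := g.transform e e' w hw hs
  rw [h, norm_zero, mul_zero] at h1
  exact (g.pos e w hw).ne' h1

theorem differentiableAt_transition (g : ConformalMetric M) (e e' : atlas ℂ M) {w : ℂ}
    (hw : w ∈ e.1.target)
    (hs : e.1.symm w ∈ e'.1.source) : DifferentiableAt ℂ (e'.1 ∘ e.1.symm) w :=
  differentiableAt_of_deriv_ne_zero (g.deriv_transition_ne_zero e e' hw hs)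

theorem isOpen_transition_domain (e e' : atlas ℂ M) :
    IsOpen (e.1.target ∩ e.1.symm ⁻¹' e'.1.source) :=
  e.1.symm.isOpen_inter_preimage e'.1.open_source

theorem differentiableAt_deriv_transition (g : ConformalMetric M) (e e' : atlas ℂ M) {w : ℂ}
    (hw : w ∈ e.1.target)
    (hs : e.1.symm w ∈ e'.1.source) : DifferentiableAt ℂ (deriv (e'.1 ∘ e.1.symm)) w := by
  have hU := isOpen_transition_domain e e'
  have hd : DifferentiableOn ℂ (e'.1 ∘ e.1.symm) (e.1.target ∩ e.1.symm ⁻¹' e'.1.source) :=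
    fun z hz => (g.differentiableAt_transition e e' hz.1 hz.2).differentiableWithinAt
  exact (hd.deriv hU).differentiableAt (hU.mem_nhds ⟨hw, hs⟩)

theorem qd_eventuallyEq (Ψ : QuadDiff M) (e e' : atlas ℂ M) {w : ℂ} (hw : w ∈ e.1.target)
    (hs : e.1.symm w ∈ e'.1.source) :
    Ψ.1 e =ᶠ[𝓝 w] fun v => Ψ.1 e' ((e'.1 ∘ e.1.symm) v) * deriv (e'.1 ∘ e.1.symm) v ^ 2 := by
  filter_upwards [(isOpen_transition_domain e e').mem_nhds ⟨hw, hs⟩] with v hv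
  exact Ψ.2.2.2 e e' v hv.1 hv.2

theorem qd_contDiffAt (Ψ : QuadDiff M) (e : atlas ℂ M) {w : ℂ} (hw : w ∈ e.1.target) :
    ContDiffAt ℝ ∞ (Ψ.1 e) w :=
  (Ψ.2.1 e).contDiffAt (e.1.open_target.mem_nhds hw)

theorem qd_differentiableAt (Ψ : QuadDiff M) (e : atlas ℂ M) {w : ℂ} (hw : w ∈ e.1.target) :
    DifferentiableAt ℝ (Ψ.1 e) w :=
  (qd_contDiffAt Ψ e hw).differentiableAt (by simp)

theorem dbarDeriv_transform (g : ConformalMetric M) (Ψ : QuadDiff M) (e e' : atlas ℂ M) {w : ℂ}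
    (hw : w ∈ e.1.target)
    (hs : e.1.symm w ∈ e'.1.source) :
    dbarDeriv (Ψ.1 e) w = dbarDeriv (Ψ.1 e') ((e'.1 ∘ e.1.symm) w) *
      (starRingEnd ℂ) (deriv (e'.1 ∘ e.1.symm) w) * deriv (e'.1 ∘ e.1.symm) w ^ 2 := by
  rw [(qd_eventuallyEq Ψ e e' hw hs).dbarDeriv_eq]
  exact dbarDeriv_comp_mul (F := e'.1 ∘ e.1.symm) (k := fun v => deriv (e'.1 ∘ e.1.symm) v ^ 2)
    (qd_differentiableAt Ψ e' (e'.1.map_source hs)) (g.differentiableAt_transition e e' hw hs)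
    ((g.differentiableAt_deriv_transition e e' hw hs).pow 2)

/-- Independence of the chart: the powers of `|τ'|` coming from `ρ` and from the coefficient cancel.
The same count underlies the next two lemmas. -/
theorem qdNorm_eq (Ψ : QuadDiff M) (e : atlas ℂ M) {x : M} (hx : x ∈ e.1.source) :
    g.qdNorm Ψ x = 2 * (g.rho e (e.1 x) ^ 2)⁻¹ * ‖Ψ.1 e (e.1 x)‖ := by
  have hw := e.1.map_source hx
  have hs : e.1.symm (e.1 x) ∈ (preferredChart x).1.source := by
    rw [e.1.left_inv hx]
    exact mem_chart_source ℂ x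
  have hne := norm_ne_zero_iff.mpr (g.deriv_transition_ne_zero e (preferredChart x) hw hs)
  have hr := (g.pos (preferredChart x) _ (mem_chart_target ℂ x)).ne'
  rw [qdNorm, g.transform e (preferredChart x) _ hw hs, Ψ.2.2.2 e (preferredChart x) _ hw hs,
    e.1.left_inv hx, norm_mul, norm_pow]
  simp only [preferredChart] at *
  field_simp

theorem dbarNorm_eq (Ψ : QuadDiff M) (e : atlas ℂ M) {x : M} (hx : x ∈ e.1.source) :
    g.dbarNorm Ψ x = 2 * Real.sqrt 2 * (g.rho e (e.1 x) ^ 3)⁻¹ * ‖dbarDeriv (Ψ.1 e) (e.1 x)‖ := by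
  have hw := e.1.map_source hx
  have hs : e.1.symm (e.1 x) ∈ (preferredChart x).1.source := by
    rw [e.1.left_inv hx]
    exact mem_chart_source ℂ x
  have hne := norm_ne_zero_iff.mpr (g.deriv_transition_ne_zero e (preferredChart x) hw hs)
  have hr := (g.pos (preferredChart x) _ (mem_chart_target ℂ x)).ne'
  rw [dbarNorm, g.transform e (preferredChart x) _ hw hs,
    g.dbarDeriv_transform Ψ e (preferredChart x) hw hs, Function.comp_apply,
    e.1.left_inv hx, norm_mul, norm_mul, norm_pow, RCLike.norm_conj]
  simp only [preferredChart] at *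
  field_simp

theorem qdInner_eq (Φ Ψ : QuadDiff M) (e : atlas ℂ M) {x : M} (hx : x ∈ e.1.source) :
    g.qdInner Φ Ψ x = 4 * (((g.rho e (e.1 x) ^ 4)⁻¹ : ℝ) : ℂ) *
      (Φ.1 e (e.1 x) * (starRingEnd ℂ) (Ψ.1 e (e.1 x))) := by
  have hw := e.1.map_source hx
  have hs : e.1.symm (e.1 x) ∈ (preferredChart x).1.source := by
    rw [e.1.left_inv hx]
    exact mem_chart_source ℂ x
  have hne := g.deriv_transition_ne_zero e (preferredChart x) hw hs
  have hr := (g.pos (preferredChart x) _ (mem_chart_target ℂ x)).ne'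
  have hr' : (g.rho (preferredChart x) (chartAt ℂ x x) : ℂ) ≠ 0 := by exact_mod_cast hr
  -- The fourth power of the modulus is split into derivative and conjugate, to match the factors of
  -- `Φ` and of the conjugate of `Ψ`.
  have hn : (‖deriv ((preferredChart x).1 ∘ e.1.symm) (e.1 x)‖ : ℂ) ^ 4 =
      (deriv ((preferredChart x).1 ∘ e.1.symm) (e.1 x) *
        (starRingEnd ℂ) (deriv ((preferredChart x).1 ∘ e.1.symm) (e.1 x))) ^ 2 := by
    rw [Complex.mul_conj']
    ring
  rw [qdInner, g.transform e (preferredChart x) _ hw hs, Φ.2.2.2 e (preferredChart x) _ hw hs,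
    Ψ.2.2.2 e (preferredChart x) _ hw hs, e.1.left_inv hx]
  have hc := (map_ne_zero (starRingEnd ℂ)).mpr hne
  push_cast
  rw [mul_pow, hn]
  simp only [map_mul, map_pow, preferredChart] at *
  field_simp

theorem continuous_of_eq_charts {Y : Type*} [TopologicalSpace Y] {f : M → Y}
    (h : ∀ e : atlas ℂ M, ∃ F : ℂ → Y, ContinuousOn F e.1.target ∧
      ∀ x ∈ e.1.source, f x = F (e.1 x)) : Continuous f := by
  rw [continuous_iff_continuousAt]
  intro x
  obtain ⟨F, hF, hfF⟩ := h (preferredChart x)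
  have hx : x ∈ (preferredChart x).1.source := mem_chart_source ℂ x
  have hev : (fun y => F ((preferredChart x).1 y)) =ᶠ[𝓝 x] f := by
    filter_upwards [(preferredChart x).1.open_source.mem_nhds hx] with y hy
    exact (hfF y hy).symm
  refine ContinuousAt.congr ?_ hev
  exact ContinuousAt.comp (g := F) (hF.continuousAt ((preferredChart x).1.open_target.mem_nhds
    ((preferredChart x).1.map_source hx))) ((preferredChart x).1.continuousAt hx)

theorem continuousOn_inv_rho_pow (e : atlas ℂ M) (n : ℕ) :
    ContinuousOn (fun w => (g.rho e w ^ n)⁻¹) e.1.target :=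
  ((g.smooth e).continuousOn.pow n).inv₀ fun w hw => (pow_pos (g.pos e w hw) n).ne'

theorem continuous_qdNorm (Ψ : QuadDiff M) : Continuous (g.qdNorm Ψ) := by
  refine continuous_of_eq_charts fun e =>
    ⟨fun w => 2 * (g.rho e w ^ 2)⁻¹ * ‖Ψ.1 e w‖, ?_, fun _ hx => g.qdNorm_eq Ψ e hx⟩
  have h1 := g.continuousOn_inv_rho_pow e 2
  have h2 := (Ψ.2.1 e).continuousOn.norm
  exact (continuousOn_const.mul h1).mul h2

theorem continuous_dbarNorm (Ψ : QuadDiff M) : Continuous (g.dbarNorm Ψ) := by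
  refine continuous_of_eq_charts fun e =>
    ⟨fun w => 2 * Real.sqrt 2 * (g.rho e w ^ 3)⁻¹ * ‖dbarDeriv (Ψ.1 e) w‖, ?_,
      fun _ hx => g.dbarNorm_eq Ψ e hx⟩
  have h1 := g.continuousOn_inv_rho_pow e 3
  have h2 := ((Ψ.2.1 e).continuousOn_dbarDeriv e.1.open_target).norm
  exact (continuousOn_const.mul h1).mul h2

theorem continuous_qdInner (Φ Ψ : QuadDiff M) : Continuous (g.qdInner Φ Ψ) := by
  refine continuous_of_eq_charts fun e =>
    ⟨fun w => 4 * (((g.rho e w ^ 4)⁻¹ : ℝ) : ℂ) * (Φ.1 e w * (starRingEnd ℂ) (Ψ.1 e w)), ?_,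
      fun _ hx => g.qdInner_eq Φ Ψ e hx⟩
  have h1 := Complex.continuous_ofReal.comp_continuousOn (g.continuousOn_inv_rho_pow e 4)
  have h2 := Complex.continuous_conj.comp_continuousOn (Ψ.2.1 e).continuousOn
  exact (continuousOn_const.mul h1).mul ((Φ.2.1 e).continuousOn.mul h2)

theorem qdNorm_nonneg (Ψ : QuadDiff M) (x : M) : 0 ≤ g.qdNorm Ψ x := by
  unfold qdNorm
  positivity

theorem qdNorm_smul (c : ℂ) (Ψ : QuadDiff M) (x : M) :
    g.qdNorm (c • Ψ) x = ‖c‖ * g.qdNorm Ψ x := by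
  simp only [qdNorm, Submodule.coe_smul, Pi.smul_apply, norm_smul]
  ring

theorem qdInner_sub_left (Φ Φ' Ψ : QuadDiff M) (x : M) :
    g.qdInner (Φ - Φ') Ψ x = g.qdInner Φ Ψ x - g.qdInner Φ' Ψ x := by
  simp only [qdInner, AddSubgroupClass.coe_sub, Pi.sub_apply]
  ring

theorem qdInner_smul_left (c : ℂ) (Φ Ψ : QuadDiff M) (x : M) :
    g.qdInner (c • Φ) Ψ x = c * g.qdInner Φ Ψ x := by
  simp only [qdInner, Submodule.coe_smul, Pi.smul_apply, smul_eq_mul]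
  ring

theorem qdInner_smul_right (c : ℂ) (Φ Ψ : QuadDiff M) (x : M) :
    g.qdInner Φ (c • Ψ) x = (starRingEnd ℂ) c * g.qdInner Φ Ψ x := by
  simp only [qdInner, Submodule.coe_smul, Pi.smul_apply, smul_eq_mul, map_mul]
  ring

theorem norm_qdInner (Φ Ψ : QuadDiff M) (x : M) :
    ‖g.qdInner Φ Ψ x‖ = g.qdNorm Φ x * g.qdNorm Ψ x := by
  have := g.pos (preferredChart x) _ (mem_chart_target ℂ x)
  simp only [qdInner, qdNorm, norm_mul, RCLike.norm_conj, Complex.norm_real, norm_inv, norm_pow,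
    Real.norm_eq_abs, abs_of_pos this]
  norm_num
  ring

theorem qdInner_self (Φ : QuadDiff M) (x : M) :
    g.qdInner Φ Φ x = ((g.qdNorm Φ x ^ 2 : ℝ) : ℂ) := by
  simp only [qdInner, qdNorm, Complex.mul_conj']
  push_cast
  ring

theorem dbarNorm_smul (c : ℂ) (Ψ : QuadDiff M) (x : M) :
    g.dbarNorm (c • Ψ) x = ‖c‖ * g.dbarNorm Ψ x := by
  have h := dbarDeriv_const_smul c
    (qd_differentiableAt Ψ (preferredChart x) (mem_chart_target ℂ x))
  simp only [dbarNorm, Submodule.coe_smul, Pi.smul_apply, h, norm_mul]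
  ring

theorem dbarNorm_sub_of_isHolomorphicQD (Ψ : QuadDiff M) {Φ : QuadDiff M}
    (hΦ : IsHolomorphicQD Φ) (x : M) : g.dbarNorm (Ψ - Φ) x = g.dbarNorm Ψ x := by
  have hx : chartAt ℂ x x ∈ (preferredChart x).1.target := mem_chart_target ℂ x
  have h := dbarDeriv_sub (qd_differentiableAt Ψ (preferredChart x) hx)
    (qd_differentiableAt Φ (preferredChart x) hx)
  have h0 := dbarDeriv_eq_zero ((hΦ (preferredChart x)).differentiableAt
    ((preferredChart x).1.open_target.mem_nhds hx))
  simp only [dbarNorm, AddSubgroupClass.coe_sub, Pi.sub_apply, h, h0, sub_zero]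

end ConformalMetric

theorem IsHolomorphicQD.sub {Φ Ψ : QuadDiff M} (hΦ : IsHolomorphicQD Φ) (hΨ : IsHolomorphicQD Ψ) :
    IsHolomorphicQD (Φ - Ψ) := fun e => (hΦ e).sub (hΨ e)

theorem IsHolomorphicQD.smul {Φ : QuadDiff M} (c : ℂ) (hΦ : IsHolomorphicQD Φ) :
    IsHolomorphicQD (c • Φ) := fun e => (hΦ e).const_smul c

theorem isHolomorphicQD_zero : IsHolomorphicQD (0 : QuadDiff M) :=
  fun _ => differentiableOn_const 0

/-! ### The area measure -/

/-- Disjoint pieces, each inside one chart, reduce an identity of measures on `M` to single charts.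
-/
theorem exists_countable_chart_cover (M : Type*) [TopologicalSpace M] [ChartedSpace ℂ M]
    [SecondCountableTopology M] [Nonempty M] [MeasurableSpace M] [BorelSpace M] :
    ∃ (e : ℕ → atlas ℂ M) (D : ℕ → Set M), (∀ n, D n ⊆ (e n).1.source) ∧
      (∀ n, MeasurableSet (D n)) ∧ Pairwise (Function.onFun Disjoint D) ∧ ⋃ n, D n = Set.univ := by
  obtain ⟨s, hs, hc⟩ := TopologicalSpace.countable_cover_nhds
    fun x : M => (chartAt ℂ x).open_source.mem_nhds (mem_chart_source ℂ x)
  have hne : s.Nonempty := by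
    rw [Set.nonempty_iff_ne_empty]
    rintro rfl
    simp only [Set.mem_empty_iff_false, Set.iUnion_of_empty, Set.iUnion_empty] at hc
    exact Set.empty_ne_univ hc
  obtain ⟨f, rfl⟩ := hs.exists_eq_range hne
  refine ⟨fun n => preferredChart (f n), disjointed fun n => (chartAt ℂ (f n)).source,
    fun n => disjointed_subset _ _,
    MeasurableSet.disjointed fun n => (chartAt ℂ (f n)).open_source.measurableSet,
    disjoint_disjointed _, ?_⟩
  rw [iUnion_disjointed, ← hc, Set.biUnion_range]

namespace ConformalMetric

variable (g : ConformalMetric M) [MeasurableSpace M] [BorelSpace M]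

theorem aemeasurable_chart_symm (e : atlas ℂ M) :
    AEMeasurable e.1.symm ((volume.restrict e.1.target).withDensity
      fun w => ENNReal.ofReal (g.rho e w ^ 2)) :=
  (e.1.continuousOn_symm.aemeasurable e.1.open_target.measurableSet).mono_ac
    (withDensity_absolutelyContinuous _ _)

theorem measurableSet_chart_preimage (e : atlas ℂ M) {A : Set M} (hA : MeasurableSet A) :
    MeasurableSet (e.1.target ∩ e.1.symm ⁻¹' A) :=
  e.1.continuousOn_symm.measurableSet_inter_preimage e.1.open_target hA

theorem chartArea_apply (e : atlas ℂ M) {A : Set M} (hA : MeasurableSet A) :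
    g.chartArea e A =
      ∫⁻ w in e.1.target ∩ e.1.symm ⁻¹' A, ENNReal.ofReal (g.rho e w ^ 2) := by
  rw [chartArea, Measure.map_apply_of_aemeasurable (g.aemeasurable_chart_symm e) hA,
    withDensity_apply', Measure.restrict_restrict' e.1.open_target.measurableSet, Set.inter_comm]

/-- The square of the factor `|τ'|` by which `ρ` changes is exactly the Jacobian of the transition
map. -/
theorem chartArea_eq_of_subset (e e' : atlas ℂ M) {A : Set M} (hA : MeasurableSet A)
    (h : A ⊆ e.1.source) (h' : A ⊆ e'.1.source) : g.chartArea e A = g.chartArea e' A := by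
  rw [g.chartArea_apply e hA, g.chartArea_apply e' hA]
  have himg : e'.1.target ∩ e'.1.symm ⁻¹' A =
      (e'.1 ∘ e.1.symm) '' (e.1.target ∩ e.1.symm ⁻¹' A) := by
    ext w
    constructor
    · rintro ⟨hw, hwA⟩
      refine ⟨e.1 (e'.1.symm w), ⟨e.1.map_source (h hwA), ?_⟩, ?_⟩
      · simpa [e.1.left_inv (h hwA)] using hwA
      · simp [e.1.left_inv (h hwA), e'.1.right_inv hw]
    · rintro ⟨v, ⟨hv, hvA⟩, rfl⟩
      refine ⟨e'.1.map_source (h' hvA), ?_⟩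
      simpa [e'.1.left_inv (h' hvA)] using hvA
  rw [himg, lintegral_image_holomorphic (measurableSet_chart_preimage e hA)
    (fun z hz => g.differentiableAt_transition e e' hz.1 (h' hz.2))]
  · refine setLIntegral_congr_fun (measurableSet_chart_preimage e hA) fun z hz => ?_
    simp only [Function.comp_apply]
    rw [← ENNReal.ofReal_mul (by positivity), g.transform e e' z hz.1 (h' hz.2)]
    congr 1
    ring
  · rintro v ⟨hv, hvA⟩ w ⟨hw, hwA⟩ hvw
    exact e.1.symm.injOn hv hw (e'.1.injOn (h' hvA) (h' hwA) hvw)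

theorem chartArea_inter_source (e : atlas ℂ M) {A : Set M} (hA : MeasurableSet A) :
    g.chartArea e A = g.chartArea e (A ∩ e.1.source) := by
  rw [g.chartArea_apply e hA, g.chartArea_apply e (hA.inter e.1.open_source.measurableSet)]
  congr 2
  ext w
  exact ⟨fun h => ⟨h.1, h.2, e.1.map_target h.1⟩, fun h => ⟨h.1, h.2.1⟩⟩

/-- Each chart measure is the part of `ν` on the chart domain, so the supremum is at most `ν`.
Cutting along a countable disjoint chart cover shows that it is no smaller. -/
theorem area_eq_of_chartArea_eq [SecondCountableTopology M] [Nonempty M] {ν : Measure M}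
    (h : ∀ (e : atlas ℂ M) (A : Set M), MeasurableSet A → A ⊆ e.1.source →
      g.chartArea e A = ν A) : g.area = ν := by
  obtain ⟨e, D, hD, hDm, hdis, hU⟩ := exists_countable_chart_cover M
  have hdec : ∀ (μ : Measure M) (A : Set M), MeasurableSet A → μ A = ∑' n, μ (A ∩ D n) := by
    intro μ A hA
    rw [← measure_iUnion (fun i j hij => (hdis hij).mono Set.inter_subset_right
      Set.inter_subset_right) (fun n => hA.inter (hDm n)), ← Set.inter_iUnion, hU, Set.inter_univ]
  apply le_antisymm
  · refine iSup_le fun e => Measure.le_iff.mpr fun A hA => ?_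
    rw [g.chartArea_inter_source e hA,
      h e _ (hA.inter e.1.open_source.measurableSet) Set.inter_subset_right]
    exact measure_mono Set.inter_subset_left
  · refine Measure.le_iff.mpr fun A hA => ?_
    rw [hdec ν A hA, hdec g.area A hA]
    refine ENNReal.tsum_le_tsum fun n => ?_
    rw [← h (e n) _ (hA.inter (hDm n)) (Set.inter_subset_right.trans (hD n))]
    exact le_iSup (fun e => g.chartArea e) (e n) _

theorem area_eq_chartArea [SecondCountableTopology M] [Nonempty M] (e : atlas ℂ M) {A : Set M}
    (hA : MeasurableSet A) (hs : A ⊆ e.1.source) : g.area A = g.chartArea e A := by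
  obtain ⟨e', D, hD, hDm, hdis, hU⟩ := exists_countable_chart_cover M
  -- The candidate for the area is the sum of the chart measures restricted to the disjoint pieces.
  have key : ∀ (e : atlas ℂ M) (A : Set M), MeasurableSet A → A ⊆ e.1.source →
      g.chartArea e A = Measure.sum (fun n => (g.chartArea (e' n)).restrict (D n)) A := by
    intro e A hA hs
    rw [Measure.sum_apply _ hA]
    have : g.chartArea e A = ∑' n, g.chartArea e (A ∩ D n) := by
      rw [← measure_iUnion (fun i j hij => (hdis hij).mono Set.inter_subset_right
        Set.inter_subset_right) (fun n => hA.inter (hDm n)), ← Set.inter_iUnion, hU,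
        Set.inter_univ]
    rw [this]
    congr 1 with n
    rw [Measure.restrict_apply hA]
    exact g.chartArea_eq_of_subset e (e' n) (hA.inter (hDm n)) (Set.inter_subset_left.trans hs)
      (Set.inter_subset_right.trans (hD n))
  rw [g.area_eq_of_chartArea_eq key, key e A hA hs]

theorem setLIntegral_area [SecondCountableTopology M] [Nonempty M] (e : atlas ℂ M) {B : Set ℂ}
    (hB : IsOpen B) (hs : B ⊆ e.1.target) {f : M → ℝ≥0∞} (hf : Measurable f) :
    ∫⁻ x in e.1.symm '' B, f x ∂g.area =
      ∫⁻ w in B, ENNReal.ofReal (g.rho e w ^ 2) * f (e.1.symm w) := by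
  have hA : IsOpen (e.1.symm '' B) := e.1.symm.isOpen_image_of_subset_source hB hs
  have hAs : e.1.symm '' B ⊆ e.1.source := by
    rintro _ ⟨w, hw, rfl⟩
    exact e.1.map_target (hs hw)
  have hpre : e.1.target ∩ e.1.symm ⁻¹' (e.1.symm '' B) = B := by
    ext w
    constructor
    · rintro ⟨hw, v, hv, hvw⟩
      rwa [← e.1.symm.injOn (hs hv) hw hvw]
    · exact fun hw => ⟨hs hw, w, hw, rfl⟩
  have hr : g.area.restrict (e.1.symm '' B) = (g.chartArea e).restrict (e.1.symm '' B) := by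
    ext A hAm
    rw [Measure.restrict_apply hAm, Measure.restrict_apply hAm]
    exact g.area_eq_chartArea e (hAm.inter hA.measurableSet) (Set.inter_subset_right.trans hAs)
  have hm : AEMeasurable (fun w => ENNReal.ofReal (g.rho e w ^ 2)) (volume.restrict e.1.target) :=
    ((g.smooth e).continuousOn.pow 2).aemeasurable e.1.open_target.measurableSet |>.ennreal_ofReal
  rw [hr, ← lintegral_indicator hA.measurableSet, chartArea,
    lintegral_map' (hf.indicator hA.measurableSet).aemeasurable (g.aemeasurable_chart_symm e),
    lintegral_withDensity_eq_lintegral_mul₀ hm, ← Set.inter_eq_self_of_subset_right hs,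
    ← lintegral_indicator e.1.open_target.measurableSet,
    ← lintegral_indicator (e.1.open_target.inter hB).measurableSet]
  · congr 1 with w
    by_cases hw : w ∈ e.1.target
    · by_cases hwB : w ∈ B
      · rw [Set.indicator_of_mem hw, Set.indicator_of_mem (show w ∈ e.1.target ∩ B from ⟨hw, hwB⟩),
          Pi.mul_apply, Set.indicator_of_mem]
        exact ⟨w, ⟨hw, hwB⟩, rfl⟩
      · rw [Set.indicator_of_mem hw, Set.indicator_of_notMem (fun h => hwB h.2), Pi.mul_apply,
          Set.indicator_of_notMem, mul_zero]
        rintro ⟨v, hv, hvw⟩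
        exact hwB (e.1.symm.injOn hv.1 hw hvw ▸ hv.2)
    · rw [Set.indicator_of_notMem hw, Set.indicator_of_notMem fun h => hw h.1]
  · exact (hf.indicator hA.measurableSet).comp_aemeasurable
      (e.1.continuousOn_symm.aemeasurable e.1.open_target.measurableSet)

theorem setLIntegral_qdNorm [SecondCountableTopology M] [Nonempty M] (e : atlas ℂ M) {B : Set ℂ}
    (hB : IsOpen B) (hs : B ⊆ e.1.target) (Ψ : QuadDiff M) :
    ∫⁻ x in e.1.symm '' B, ENNReal.ofReal (g.qdNorm Ψ x) ∂g.area = 2 * ∫⁻ w in B, ‖Ψ.1 e w‖ₑ := by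
  rw [g.setLIntegral_area e hB hs (g.continuous_qdNorm Ψ).measurable.ennreal_ofReal,
    ← lintegral_const_mul' _ _ (by simp)]
  refine setLIntegral_congr_fun hB.measurableSet fun w hw => ?_
  have hp := g.pos e w (hs hw)
  rw [g.qdNorm_eq Ψ e (e.1.map_target (hs hw)), e.1.right_inv (hs hw),
    ← ENNReal.ofReal_mul (by positivity), ← ofReal_norm,
    show (2 : ℝ≥0∞) = ENNReal.ofReal 2 by simp, ← ENNReal.ofReal_mul (by positivity)]
  congr 1
  field_simp

theorem setLIntegral_dbarNorm [SecondCountableTopology M] [Nonempty M] (e : atlas ℂ M)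
    {B : Set ℂ} (hB : IsOpen B) (hs : B ⊆ e.1.target) (Ψ : QuadDiff M) :
    ∫⁻ x in e.1.symm '' B, ENNReal.ofReal (g.dbarNorm Ψ x) ∂g.area =
      ∫⁻ w in B, ENNReal.ofReal (2 * Real.sqrt 2 * (g.rho e w)⁻¹) * ‖dbarDeriv (Ψ.1 e) w‖ₑ := by
  rw [g.setLIntegral_area e hB hs (g.continuous_dbarNorm Ψ).measurable.ennreal_ofReal]
  refine setLIntegral_congr_fun hB.measurableSet fun w hw => ?_
  have hp := g.pos e w (hs hw)
  rw [g.dbarNorm_eq Ψ e (e.1.map_target (hs hw)), e.1.right_inv (hs hw),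
    ← ENNReal.ofReal_mul (by positivity), ← ofReal_norm, ← ENNReal.ofReal_mul (by positivity)]
  congr 1
  field_simp

end ConformalMetric

end RiemannSurface

section RiemannSurface

variable {M : Type*} [TopologicalSpace M] [ChartedSpace ℂ M]

/-! ### Flat metrics: holomorphic differentials have constant norm -/

namespace ConformalMetric

variable (g : ConformalMetric M)

/-- Zero curvature means that `log ρ` is harmonic, and on a disc a harmonic function is the real
part of an analytic one. -/
theorem IsFlat.exists_analytic {g : ConformalMetric M} (hg : g.IsFlat) (e : atlas ℂ M) {w : ℂ}
    {r : ℝ} (hs : Metric.ball w r ⊆ e.1.target) :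
    ∃ F : ℂ → ℂ, AnalyticOnNhd ℂ F (Metric.ball w r) ∧
      ∀ v ∈ Metric.ball w r, (F v).re = Real.log (g.rho e v) := by
  have hh : InnerProductSpace.HarmonicOnNhd (fun v => Real.log (g.rho e v)) (Metric.ball w r) := by
    intro v hv
    refine ⟨?_, ?_⟩
    · exact (((g.smooth e).contDiffAt (e.1.open_target.mem_nhds (hs hv))).log
        (g.pos e v (hs hv)).ne').of_le (by exact WithTop.coe_le_coe.mpr le_top)
    · filter_upwards [e.1.open_target.mem_nhds (hs hv)] with y hy
      have h := hg e y hy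
      rw [gaussCurvature, neg_eq_zero, mul_eq_zero] at h
      exact h.resolve_left (inv_ne_zero (pow_ne_zero 2 (g.pos e y hy).ne'))
  obtain ⟨F, h1, h2⟩ := InnerProductSpace.HarmonicOnNhd.exists_analyticOnNhd_ball_re_eq hh
  exact ⟨F, h1, fun v hv => h2 hv⟩

/-- Since `|exp (-2F)| = ρ⁻²`, the norm is `2 |k|` with `k = ψ exp (-2F)` holomorphic, and the
maximum modulus principle applies to `k`. -/
theorem IsFlat.qdNorm_eventuallyEq_of_isMax {g : ConformalMetric M} (hg : g.IsFlat)
    {Θ : QuadDiff M} (hΘ : IsHolomorphicQD Θ) {x : M} (hx : ∀ y, g.qdNorm Θ y ≤ g.qdNorm Θ x) :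
    ∀ᶠ y in 𝓝 x, g.qdNorm Θ y = g.qdNorm Θ x := by
  set e : atlas ℂ M := preferredChart x
  have hxe : x ∈ e.1.source := mem_chart_source ℂ x
  set w := e.1 x
  have hw : w ∈ e.1.target := e.1.map_source hxe
  obtain ⟨r, hr, hs⟩ := Metric.isOpen_iff.mp e.1.open_target w hw
  obtain ⟨F, hF, hFre⟩ := hg.exists_analytic e hs
  let k : ℂ → ℂ := fun v => Θ.1 e v * Complex.exp (-2 * F v)
  have hk : DifferentiableOn ℂ k (Metric.ball w r) :=
    ((hΘ e).mono hs).mul (hF.differentiableOn.const_mul _).cexp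
  have hkn : ∀ v ∈ Metric.ball w r, g.qdNorm Θ (e.1.symm v) = 2 * ‖k v‖ := by
    intro v hv
    have hp := g.pos e v (hs hv)
    rw [g.qdNorm_eq Θ e (e.1.map_target (hs hv)), e.1.right_inv (hs hv), norm_mul,
      Complex.norm_exp]
    have : (-2 * F v).re = -(Real.log (g.rho e v) + Real.log (g.rho e v)) := by
      simp [hFre v hv]
      ring
    rw [this, Real.exp_neg, Real.exp_add, Real.exp_log hp]
    ring
  have hmem : w ∈ Metric.ball w r := Metric.mem_ball_self hr
  have hball := Metric.isOpen_ball.mem_nhds hmem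
  have hwx : e.1.symm w = x := e.1.left_inv hxe
  have hmax : IsLocalMax (norm ∘ k) w := by
    filter_upwards [hball] with v hv
    have := hx (e.1.symm v)
    rw [← hwx, hkn v hv, hkn w hmem] at this
    simp only [Function.comp_apply]
    linarith
  have hconst := Complex.eventually_eq_of_isLocalMax_norm
    (by filter_upwards [hball] with v hv using hk.differentiableAt (Metric.isOpen_ball.mem_nhds hv))
    hmax
  filter_upwards [(e.1.continuousAt hxe).eventually hconst, (e.1.continuousAt hxe).eventually hball,
    e.1.open_source.mem_nhds hxe] with y hy1 hy2 hy3
  have h1 := hkn _ hy2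
  have h2 := hkn w hmem
  rw [e.1.left_inv hy3] at h1
  rw [hwx] at h2
  rw [h1, h2, hy1]

/-- The maximum is attained by compactness, and the set where it is attained is both closed and
open. -/
theorem IsFlat.exists_qdNorm_eq_const [CompactSpace M] [PreconnectedSpace M] [Nonempty M]
    {g : ConformalMetric M} (hg : g.IsFlat) {Θ : QuadDiff M} (hΘ : IsHolomorphicQD Θ) :
    ∃ c : ℝ, ∀ x, g.qdNorm Θ x = c := by
  obtain ⟨x, -, hx⟩ := isCompact_univ.exists_isMaxOn Set.univ_nonempty
    (g.continuous_qdNorm Θ).continuousOn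
  have hx' : ∀ y, g.qdNorm Θ y ≤ g.qdNorm Θ x := fun y => hx (Set.mem_univ y)
  refine ⟨g.qdNorm Θ x, fun y => ?_⟩
  have hcl : IsClopen {y | g.qdNorm Θ y = g.qdNorm Θ x} := by
    refine ⟨isClosed_eq (g.continuous_qdNorm Θ) continuous_const, isOpen_iff_mem_nhds.mpr ?_⟩
    intro y hy
    have hy' : g.qdNorm Θ y = g.qdNorm Θ x := hy
    have := hg.qdNorm_eventuallyEq_of_isMax hΘ (x := y) (by rwa [hy'])
    rwa [hy'] at this
  have : y ∈ {y | g.qdNorm Θ y = g.qdNorm Θ x} := by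
    rw [hcl.eq_univ ⟨x, rfl⟩]
    trivial
  exact this

theorem eq_zero_of_qdNorm_eq_zero {Θ : QuadDiff M} (h : ∀ x, g.qdNorm Θ x = 0) : Θ = 0 := by
  ext e w
  by_cases hw : w ∈ e.1.target
  · have h1 := h (e.1.symm w)
    rw [g.qdNorm_eq Θ e (e.1.map_target hw), e.1.right_inv hw] at h1
    have := (g.pos e w hw).ne'
    simpa [this] using h1
  · exact Θ.2.2.1 e w hw

/-- Choose `c` so that `Θ' - c • Θ` vanishes at one point; its norm is constant, so it vanishes
everywhere. The choice is possible because a nonzero `Θ` has no zeros. -/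
theorem IsFlat.exists_smul_eq [CompactSpace M] [PreconnectedSpace M] [Nonempty M]
    {g : ConformalMetric M} (hg : g.IsFlat) {Θ Θ' : QuadDiff M} (hΘ : IsHolomorphicQD Θ)
    (hΘ' : IsHolomorphicQD Θ') (h0 : Θ ≠ 0) : ∃ c : ℂ, Θ' = c • Θ := by
  obtain ⟨x⟩ := ‹Nonempty M›
  set e := preferredChart x
  have hx : x ∈ e.1.source := mem_chart_source ℂ x
  have : Nonempty M := ⟨x⟩
  have hne : Θ.1 e (e.1 x) ≠ 0 := by
    intro h
    obtain ⟨c, hc⟩ := hg.exists_qdNorm_eq_const hΘ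
    have hc0 : c = 0 := by rw [← hc x, g.qdNorm_eq Θ e hx, h, norm_zero, mul_zero]
    exact h0 (g.eq_zero_of_qdNorm_eq_zero fun y => by rw [hc y, hc0])
  refine ⟨Θ'.1 e (e.1 x) / Θ.1 e (e.1 x), ?_⟩
  rw [← sub_eq_zero]
  obtain ⟨c, hc⟩ := hg.exists_qdNorm_eq_const
    (hΘ'.sub (hΘ.smul (Θ'.1 e (e.1 x) / Θ.1 e (e.1 x))))
  refine g.eq_zero_of_qdNorm_eq_zero fun y => ?_
  rw [hc y, ← hc x, g.qdNorm_eq _ e hx]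
  simp [div_mul_cancel₀ _ hne]

/-! ### The orthogonal projection onto the holomorphic differentials -/

variable [MeasurableSpace M]

theorem integrable_qdInner [BorelSpace M] [CompactSpace M] (h : g.area Set.univ = 1)
    (Φ Ψ : QuadDiff M) :
    Integrable (g.qdInner Φ Ψ) g.area := by
  have : IsFiniteMeasure g.area := ⟨by simp [h]⟩
  obtain ⟨B, hB⟩ := isCompact_univ.exists_bound_of_continuousOn
    (g.continuous_qdInner Φ Ψ).continuousOn
  exact Integrable.of_bound (g.continuous_qdInner Φ Ψ).aestronglyMeasurable B
    (Eventually.of_forall fun x => hB x (Set.mem_univ x))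

theorem l2Inner_sub_left [BorelSpace M] [CompactSpace M]
    (h : g.area Set.univ = 1) (Φ Φ' Ψ : QuadDiff M) :
    g.l2Inner (Φ - Φ') Ψ = g.l2Inner Φ Ψ - g.l2Inner Φ' Ψ := by
  unfold l2Inner
  rw [← integral_sub (g.integrable_qdInner h Φ Ψ) (g.integrable_qdInner h Φ' Ψ)]
  simp only [qdInner_sub_left]

theorem l2Inner_smul_left (c : ℂ) (Φ Ψ : QuadDiff M) :
    g.l2Inner (c • Φ) Ψ = c * g.l2Inner Φ Ψ := by
  unfold l2Inner
  rw [← integral_const_mul]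
  simp only [qdInner_smul_left]

theorem l2Inner_smul_right (c : ℂ) (Φ Ψ : QuadDiff M) :
    g.l2Inner Φ (c • Ψ) = (starRingEnd ℂ) c * g.l2Inner Φ Ψ := by
  unfold l2Inner
  rw [← integral_const_mul]
  simp only [qdInner_smul_right]

theorem IsFlat.eq_zero_of_l2Inner_self [CompactSpace M] [PreconnectedSpace M] [Nonempty M]
    {g : ConformalMetric M} (hg : g.IsFlat) (h : g.area Set.univ = 1) {Θ : QuadDiff M}
    (hΘ : IsHolomorphicQD Θ) (h0 : g.l2Inner Θ Θ = 0) : Θ = 0 := by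
  obtain ⟨c, hc⟩ := hg.exists_qdNorm_eq_const hΘ
  have : g.l2Inner Θ Θ = ((c ^ 2 : ℝ) : ℂ) := by
    simp only [l2Inner, qdInner_self, hc]
    simp [Measure.real, h]
  rw [this] at h0
  have hc0 : c = 0 := by
    have : c ^ 2 = 0 := by exact_mod_cast h0
    exact pow_eq_zero_iff (two_ne_zero) |>.mp this
  exact g.eq_zero_of_qdNorm_eq_zero fun y => by rw [hc y, hc0]

/-- All holomorphic differentials are multiples of one, so projecting onto that one suffices.
Uniqueness is definiteness of the inner product on holomorphic differentials. -/
theorem IsFlat.existsUnique_isHolomorphicPart [BorelSpace M] [CompactSpace M] [PreconnectedSpace M]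
    [Nonempty M] {g : ConformalMetric M} (hg : g.IsFlat) (h : g.area Set.univ = 1)
      (Ψ : QuadDiff M) :
    ∃! Φ : QuadDiff M, g.IsHolomorphicPart Ψ Φ := by
  refine existsUnique_of_exists_of_unique ?_ ?_
  · by_cases hH : ∃ Θ : QuadDiff M, IsHolomorphicQD Θ ∧ Θ ≠ 0
    · obtain ⟨Θ, hΘ, h0⟩ := hH
      have hne : g.l2Inner Θ Θ ≠ 0 := fun h' => h0 (hg.eq_zero_of_l2Inner_self h hΘ h')
      refine ⟨(g.l2Inner Ψ Θ / g.l2Inner Θ Θ) • Θ, hΘ.smul _, fun Θ' hΘ' => ?_⟩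
      obtain ⟨c, rfl⟩ := hg.exists_smul_eq hΘ hΘ' h0
      rw [g.l2Inner_smul_right, g.l2Inner_sub_left h, g.l2Inner_smul_left, div_mul_cancel₀ _ hne,
        sub_self, mul_zero]
    · push Not at hH
      refine ⟨0, isHolomorphicQD_zero, fun Θ hΘ => ?_⟩
      simp [hH Θ hΘ, l2Inner, qdInner]
  · rintro Φ Φ' ⟨h1, h2⟩ ⟨h1', h2'⟩
    have hd := h1.sub h1'
    rw [← sub_eq_zero]
    refine hg.eq_zero_of_l2Inner_self h hd ?_
    have e : Φ - Φ' = (Ψ - Φ') - (Ψ - Φ) := by abel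
    conv_lhs => rw [e]
    rw [g.l2Inner_sub_left h, h2' _ (e ▸ hd), h2 _ (e ▸ hd), sub_self]

end ConformalMetric

end RiemannSurface

/-! ### Compactness: limits along an ultrafilter -/

/-- A Montel argument in which an ultrafilter replaces the choice of subsequences: the bounded
approximants `H i` converge pointwise along `U`, and their common Lipschitz constant with total
boundedness of the disc makes the convergence uniform. The distance from `ψ i` to `H i` tends to
zero in `L¹` with `∂̄`. -/
theorem exists_holomorphic_limit {ι : Type*} (U : Ultrafilter ι) (c : ℂ) {R : ℝ} (hR : 0 < R)
    (ψ : ι → ℂ → ℂ) (hψ : ∀ i, ContDiffOn ℝ ∞ (ψ i) (Metric.ball c R)) (A : ℝ≥0)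
    (hA : ∀ i, ∫⁻ z in Metric.ball c R, ‖ψ i z‖ₑ ≤ A)
    (hd : Tendsto (fun i => ∫⁻ z in Metric.ball c R, ‖dbarDeriv (ψ i) z‖ₑ) U (𝓝 0)) :
    ∃ h : ℂ → ℂ, DifferentiableOn ℂ h (Metric.ball c (R / 4)) ∧
      Tendsto (fun i => ∫⁻ z in Metric.ball c (R / 4), ‖ψ i z - h z‖ₑ) U (𝓝 0) := by
  obtain ⟨K, hK⟩ := exists_holomorphic_approx c hR
  choose H hHd hH1 hH2 hH3 using fun i => hK (ψ i) (hψ i)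
  set B := Metric.ball c (R / 4) with hB
  have hb : ∀ i, ∀ z ∈ B, ‖H i z‖ ≤ K * A := fun i z hz => by
    have h : ‖H i z‖ₑ ≤ ((K * A : ℝ≥0) : ℝ≥0∞) := by
      rw [ENNReal.coe_mul]
      exact (hH2 i z hz).trans (by gcongr; exact hA i)
    exact_mod_cast enorm_le_coe.mp h
  have hl : ∀ i, ∀ z ∈ B, ∀ y ∈ B, ‖H i z - H i y‖ ≤ K * A * ‖z - y‖ := fun i z hz y hy => by
    have h : ‖H i z - H i y‖ₑ ≤ ((K * A * ‖z - y‖₊ : ℝ≥0) : ℝ≥0∞) := by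
      rw [ENNReal.coe_mul, ENNReal.coe_mul]
      exact (hH3 i z hz y hy).trans (by gcongr; exacts [hA i, le_rfl])
    exact_mod_cast enorm_le_coe.mp h
  have hlim : ∀ z ∈ B, ∃ l, Tendsto (fun i => H i z) U (𝓝 l) := by
    intro z hz
    obtain ⟨l, -, hl⟩ := (isCompact_closedBall (0 : ℂ) (K * A)).ultrafilter_le_nhds
      (U.map fun i => H i z) (le_principal_iff.mpr (mem_map.mpr (Eventually.of_forall fun i => by
        simpa using hb i z hz)))
    exact ⟨l, hl⟩
  choose! h hh using hlim
  have hhl : ∀ z ∈ B, ∀ y ∈ B, ‖h z - h y‖ ≤ K * A * ‖z - y‖ := fun z hz y hy =>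
    le_of_tendsto ((hh z hz).sub (hh y hy)).norm (Eventually.of_forall fun i => hl i z hz y hy)
  have hunif : TendstoUniformlyOn H h U B := by
    rw [Metric.tendstoUniformlyOn_iff]
    intro ε hε
    -- Adding one keeps the divisor positive when `K * A = 0`.
    set L : ℝ := K * A + 1
    have hL : 0 < L := by positivity
    obtain ⟨t, htB, htf, htc⟩ := Metric.finite_approx_of_totallyBounded
      ((isCompact_closedBall c (R / 4)).totallyBounded.subset Metric.ball_subset_closedBall)
      (ε / (3 * L)) (by positivity)
    have hev : ∀ᶠ i in (U : Filter ι), ∀ y ∈ t, dist (h y) (H i y) < ε / 3 := by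
      rw [eventually_all_finite htf]
      intro y hy
      have := (Metric.tendsto_nhds.mp (hh y (htB hy))) (ε / 3) (by positivity)
      filter_upwards [this] with i hi
      rwa [dist_comm]
    filter_upwards [hev] with i hi z hz
    obtain ⟨y, hy, hzy⟩ := Set.mem_iUnion₂.mp (htc hz)
    have hzy' : K * A * ‖z - y‖ ≤ ε / 3 := by
      have h1 : ‖z - y‖ < ε / (3 * L) := by rwa [← dist_eq_norm]
      calc K * A * ‖z - y‖ ≤ L * (ε / (3 * L)) := by gcongr; simp [L]
        _ = ε / 3 := by field_simp
    have h1 := hhl z hz y (htB hy)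
    have h2 := hl i y (htB hy) z hz
    rw [norm_sub_rev y z] at h2
    have h3 := hi y hy
    rw [dist_eq_norm] at h3 ⊢
    calc ‖h z - H i z‖ = ‖(h z - h y) + (h y - H i y) + (H i y - H i z)‖ := by ring_nf
      _ ≤ ‖h z - h y‖ + ‖h y - H i y‖ + ‖H i y - H i z‖ := norm_add₃_le
      _ < ε := by linarith
  have hhd : DifferentiableOn ℂ h B := hunif.tendstoLocallyUniformlyOn.differentiableOn
    (Eventually.of_forall hHd) Metric.isOpen_ball
  refine ⟨h, hhd, ?_⟩
  have hle : ∀ i, ∫⁻ z in B, ‖ψ i z - h z‖ₑ ≤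
      K * (∫⁻ z in Metric.ball c R, ‖dbarDeriv (ψ i) z‖ₑ) + ∫⁻ z in B, ‖H i z - h z‖ₑ := by
    intro i
    refine le_trans ?_ (add_le_add_left (hH1 i) _)
    rw [← lintegral_add_right']
    · refine lintegral_mono fun z => ?_
      calc ‖ψ i z - h z‖ₑ = ‖(ψ i z - H i z) + (H i z - h z)‖ₑ := by ring_nf
        _ ≤ _ := enorm_add_le _ _
    · exact (((hHd i).continuousOn.sub hhd.continuousOn).aemeasurable
        Metric.isOpen_ball.measurableSet).enorm
  have h1 := ENNReal.Tendsto.const_mul hd (Or.inr (ENNReal.coe_ne_top (r := K)))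
  have h2 : Tendsto (fun i => ∫⁻ z in B, ‖H i z - h z‖ₑ) U (𝓝 0) := by
    rw [ENNReal.tendsto_nhds_zero]
    intro ε hε
    have hv : volume B ≠ ⊤ := measure_ball_lt_top.ne
    obtain ⟨δ, hδ, hδε⟩ := ENNReal.exists_nnreal_pos_mul_lt hv hε.ne'
    filter_upwards [(Metric.tendstoUniformlyOn_iff.mp hunif) δ hδ] with i hi
    calc ∫⁻ z in B, ‖H i z - h z‖ₑ ≤ ∫⁻ z in B, (δ : ℝ≥0∞) := by
          refine setLIntegral_mono' Metric.isOpen_ball.measurableSet fun z hz => ?_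
          have := hi z hz
          rw [dist_comm, dist_eq_norm] at this
          exact enorm_le_coe.mpr (by exact_mod_cast this.le)
      _ = δ * volume B := by simp
      _ ≤ ε := hδε.le
  have h3 := h1.add h2
  rw [mul_zero, add_zero] at h3
  exact tendsto_of_tendsto_of_tendsto_of_le_of_le tendsto_const_nhds h3 (fun i => zero_le) hle

theorem setLIntegral_biUnion_finset_le {X ι : Type*} [MeasurableSpace X] (μ : Measure X)
    (t : Finset ι) (W : ι → Set X) (f : X → ℝ≥0∞) :
    ∫⁻ y in ⋃ x ∈ t, W x, f y ∂μ ≤ ∑ x ∈ t, ∫⁻ y in W x, f y ∂μ := by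
  classical
  induction t using Finset.induction_on with
  | empty => simp
  | insert a t ha ih =>
    rw [Finset.set_biUnion_insert, Finset.sum_insert ha]
    exact (lintegral_union_le _ _ _).trans (add_le_add_right ih _)


/-! ### Gluing local limits into a global holomorphic differential -/

section RiemannSurface

variable {M : Type*} [TopologicalSpace M] [ChartedSpace ℂ M]

/-- The coefficients of the `u i` in the chart `e` converge to `h` in `L¹(V)` along `U`. -/
def TendstoInChart {ι : Type*} (U : Filter ι) (u : ι → QuadDiff M) (e : atlas ℂ M) (V : Set ℂ)
    (h : ℂ → ℂ) : Prop :=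
  Tendsto (fun i => ∫⁻ z in V, ‖(u i).1 e z - h z‖ₑ) U (𝓝 0)

namespace ConformalMetric

/-- The two sides are `L¹` limits, near `v`, of the same coefficients, which obey the transformation
law. They agree almost everywhere, hence everywhere by continuity. -/
theorem tendstoInChart_transform (g : ConformalMetric M) {ι : Type*} {U : Filter ι} [U.NeBot]
    {u : ι → QuadDiff M} {e e' : atlas ℂ M} {V V' : Set ℂ} {h h' : ℂ → ℂ}
    (hV : IsOpen V) (hV' : IsOpen V') (hVe : V ⊆ e.1.target)
    (hc : ContinuousOn h V) (hc' : ContinuousOn h' V') (ht : TendstoInChart U u e V h)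
    (ht' : TendstoInChart U u e' V' h') {v : ℂ} (hv : v ∈ V) (hs : e.1.symm v ∈ e'.1.source)
    (hv' : (e'.1 ∘ e.1.symm) v ∈ V') :
    h v = h' ((e'.1 ∘ e.1.symm) v) * deriv (e'.1 ∘ e.1.symm) v ^ 2 := by
  set τ := e'.1 ∘ e.1.symm
  have hD := isOpen_transition_domain e e'
  have hτd : ∀ z ∈ e.1.target ∩ e.1.symm ⁻¹' e'.1.source, DifferentiableAt ℂ τ z :=
    fun z hz => g.differentiableAt_transition e e' hz.1 hz.2
  have hτc : ContinuousOn τ (e.1.target ∩ e.1.symm ⁻¹' e'.1.source) :=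
    fun z hz => (hτd z hz).continuousAt.continuousWithinAt
  set W := V ∩ ((e.1.target ∩ e.1.symm ⁻¹' e'.1.source) ∩ τ ⁻¹' V')
  have hW : IsOpen W := hV.inter (hτc.isOpen_inter_preimage hD hV')
  have hvW : v ∈ W := ⟨hv, ⟨hVe hv, hs⟩, hv'⟩
  have hinj : Set.InjOn τ W := by
    rintro a ⟨-, ⟨ha, ha'⟩, -⟩ b ⟨-, ⟨hb, hb'⟩, -⟩ hab
    exact e.1.symm.injOn ha hb (e'.1.injOn ha' hb' hab)
  have hcW : ContinuousOn h W := hc.mono Set.inter_subset_left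
  have hdc : ContinuousOn (deriv τ) W := fun z hz =>
    (g.differentiableAt_deriv_transition e e' hz.2.1.1 hz.2.1.2).continuousAt.continuousWithinAt
  have hcW' : ContinuousOn (fun z => h' (τ z) * deriv τ z ^ 2) W :=
    (hc'.comp (hτc.mono fun z hz => hz.2.1) fun z hz => hz.2.2).mul (hdc.pow 2)
  have huc : ∀ i, ContinuousOn ((u i).1 e) W := fun i =>
    (u i).2.1 e |>.continuousOn.mono fun z hz => hz.2.1.1
  have hle : ∀ i, ∫⁻ z in W, ‖h z - h' (τ z) * deriv τ z ^ 2‖ₑ ≤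
      (∫⁻ z in V, ‖(u i).1 e z - h z‖ₑ) + ∫⁻ z in V', ‖(u i).1 e' z - h' z‖ₑ := by
    intro i
    calc ∫⁻ z in W, ‖h z - h' (τ z) * deriv τ z ^ 2‖ₑ
        ≤ ∫⁻ z in W, (‖(u i).1 e z - h z‖ₑ + ‖(u i).1 e z - h' (τ z) * deriv τ z ^ 2‖ₑ) := by
          refine lintegral_mono fun z => ?_
          rw [← enorm_sub_rev (h z)]
          refine le_trans (le_of_eq ?_) (enorm_add_le _ _)
          ring_nf
      _ = (∫⁻ z in W, ‖(u i).1 e z - h z‖ₑ) +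
          ∫⁻ z in W, ‖(u i).1 e z - h' (τ z) * deriv τ z ^ 2‖ₑ :=
          lintegral_add_left' (((huc i).sub hcW).aemeasurable hW.measurableSet).enorm _
      _ = (∫⁻ z in W, ‖(u i).1 e z - h z‖ₑ) + ∫⁻ z in τ '' W, ‖(u i).1 e' z - h' z‖ₑ := by
          congr 1
          rw [lintegral_image_holomorphic hW.measurableSet (fun z hz => hτd z hz.2.1) hinj]
          refine setLIntegral_congr_fun hW.measurableSet fun z hz => ?_
          have h1 : (u i).1 e z = (u i).1 e' (τ z) * deriv τ z ^ 2 :=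
            (u i).2.2.2 e e' z hz.2.1.1 hz.2.1.2
          -- The Jacobian equals the modulus of the factor in the transformation law, so `L¹`
          -- distances of coefficients do not depend on the chart.
          have h2 : ENNReal.ofReal (‖deriv τ z‖ ^ 2) = ‖deriv τ z ^ 2‖ₑ := by
            rw [← norm_pow, ofReal_norm]
          simp only [h1, h2]
          rw [← sub_mul, enorm_mul, mul_comm]
      _ ≤ _ := by
          gcongr
          · exact Set.inter_subset_left
          · rintro _ ⟨z, hz, rfl⟩
            exact hz.2.2
  have h0 : ∫⁻ z in W, ‖h z - h' (τ z) * deriv τ z ^ 2‖ₑ = 0 := by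
    have := ge_of_tendsto (ht.add ht') (Eventually.of_forall hle)
    simpa using this
  have h0' := (lintegral_eq_zero_iff' ((hcW.sub hcW').aemeasurable hW.measurableSet).enorm).mp h0
  have hae : h =ᵐ[volume.restrict W] fun z => h' (τ z) * deriv τ z ^ 2 := by
    filter_upwards [h0'] with z hz
    simpa [sub_eq_zero] using hz
  exact Measure.eqOn_open_of_ae_eq hae hW hcW hcW' hvW

theorem tendstoInChart_unique (g : ConformalMetric M) {ι : Type*} {U : Filter ι} [U.NeBot]
    {u : ι → QuadDiff M} {e : atlas ℂ M} {V V' : Set ℂ} {h h' : ℂ → ℂ}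
    (hV : IsOpen V) (hV' : IsOpen V') (hVe : V ⊆ e.1.target)
    (hc : ContinuousOn h V) (hc' : ContinuousOn h' V') (ht : TendstoInChart U u e V h)
    (ht' : TendstoInChart U u e V' h') {v : ℂ} (hv : v ∈ V) (hv' : v ∈ V') : h v = h' v := by
  have hid : (e.1 ∘ e.1.symm) =ᶠ[𝓝 v] id := by
    filter_upwards [e.1.open_target.mem_nhds (hVe hv)] with y hy using e.1.right_inv hy
  have := g.tendstoInChart_transform hV hV' hVe hc hc' ht ht' hv (e.1.map_target (hVe hv))
    (by rwa [hid.self_of_nhds])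
  rw [hid.self_of_nhds, hid.deriv_eq] at this
  simpa using this

variable [MeasurableSpace M]

theorem exists_tendstoInChart [BorelSpace M] [SecondCountableTopology M] [Nonempty M]
    (g : ConformalMetric M)
    {ι : Type*} (U : Ultrafilter ι) (u : ι → QuadDiff M) (h1 : ∀ i, g.l1Norm (u i) ≤ 1)
    (h2 : Tendsto (fun i => g.l1NormDbar (u i)) U (𝓝 0)) (e : atlas ℂ M) {w : ℂ}
    (hw : w ∈ e.1.target) :
    ∃ r : ℝ, 0 < r ∧ Metric.ball w r ⊆ e.1.target ∧ ∃ h : ℂ → ℂ,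
      DifferentiableOn ℂ h (Metric.ball w r) ∧ TendstoInChart U u e (Metric.ball w r) h := by
  obtain ⟨R, hR, hs'⟩ := Metric.nhds_basis_closedBall.mem_iff.mp (e.1.open_target.mem_nhds hw)
  have hs : Metric.ball w R ⊆ e.1.target := Metric.ball_subset_closedBall.trans hs'
  have hu : ∀ i, ContDiffOn ℝ ∞ ((u i).1 e) (Metric.ball w R) := fun i => ((u i).2.1 e).mono hs
  -- An upper bound for `ρ` bounds the weight `2√2 ρ⁻¹` of the `∂̄` norm from below. No such bound
  -- is needed for `Ψ` itself, where the powers of `ρ` cancel.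
  obtain ⟨B, hB⟩ := (isCompact_closedBall w R).exists_bound_of_continuousOn
    ((g.smooth e).continuousOn.mono hs')
  have hA : ∀ i, ∫⁻ z in Metric.ball w R, ‖(u i).1 e z‖ₑ ≤ (1 : ℝ≥0) := by
    intro i
    calc ∫⁻ z in Metric.ball w R, ‖(u i).1 e z‖ₑ
        ≤ 2 * ∫⁻ z in Metric.ball w R, ‖(u i).1 e z‖ₑ := le_mul_of_one_le_left' one_le_two
      _ = _ := (g.setLIntegral_qdNorm e Metric.isOpen_ball hs (u i)).symm
      _ ≤ g.l1Norm (u i) := setLIntegral_le_lintegral _ _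
      _ ≤ _ := by simpa using h1 i
  have hd : Tendsto (fun i => ∫⁻ z in Metric.ball w R, ‖dbarDeriv ((u i).1 e) z‖ₑ) U (𝓝 0) := by
    refine tendsto_of_tendsto_of_tendsto_of_le_of_le (h := fun i => ENNReal.ofReal B *
      g.l1NormDbar (u i)) tendsto_const_nhds ?_ (fun i => zero_le) fun i => ?_
    · simpa using ENNReal.Tendsto.const_mul h2 (Or.inr (ENNReal.ofReal_ne_top (r := B)))
    · calc ∫⁻ z in Metric.ball w R, ‖dbarDeriv ((u i).1 e) z‖ₑ
          ≤ ∫⁻ z in Metric.ball w R, ENNReal.ofReal B *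
              (ENNReal.ofReal (2 * Real.sqrt 2 * (g.rho e z)⁻¹) * ‖dbarDeriv ((u i).1 e) z‖ₑ) := by
            refine setLIntegral_mono' Metric.isOpen_ball.measurableSet fun z hz => ?_
            have hp := g.pos e z (hs hz)
            have hb := hB z (Metric.ball_subset_closedBall hz)
            rw [Real.norm_eq_abs, abs_of_pos hp] at hb
            rw [← mul_assoc, ← ENNReal.ofReal_mul (hp.le.trans hb)]
            refine le_mul_of_one_le_left' ?_
            rw [← ENNReal.ofReal_one]
            apply ENNReal.ofReal_le_ofReal
            have h3 : 1 ≤ B * (g.rho e z)⁻¹ := by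
              rw [← div_eq_mul_inv, one_le_div hp]
              exact hb
            have h4 : 1 ≤ Real.sqrt 2 := Real.one_le_sqrt.mpr one_le_two
            nlinarith
        _ = ENNReal.ofReal B * ∫⁻ x in e.1.symm '' Metric.ball w R,
              ENNReal.ofReal (g.dbarNorm (u i) x) ∂g.area := by
            rw [lintegral_const_mul' _ _ ENNReal.ofReal_ne_top,
              g.setLIntegral_dbarNorm e Metric.isOpen_ball hs (u i)]
        _ ≤ ENNReal.ofReal B * g.l1NormDbar (u i) :=
            mul_le_mul_right (setLIntegral_le_lintegral _ _) _
  obtain ⟨h, hh1, hh2⟩ := exists_holomorphic_limit U w hR (fun i => (u i).1 e) hu 1 hA hd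
  exact ⟨R / 4, by positivity, (Metric.ball_subset_ball (by linarith)).trans hs, h, hh1, hh2⟩

theorem exists_holomorphic_l1_limit [BorelSpace M] [SecondCountableTopology M] [CompactSpace M]
    [Nonempty M]
    (g : ConformalMetric M) {ι : Type*} (U : Ultrafilter ι) (u : ι → QuadDiff M)
    (h1 : ∀ i, g.l1Norm (u i) ≤ 1) (h2 : Tendsto (fun i => g.l1NormDbar (u i)) U (𝓝 0)) :
    ∃ Φ : QuadDiff M, IsHolomorphicQD Φ ∧
      Tendsto (fun i => g.l1Norm (u i - Φ)) U (𝓝 0) := by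
  classical
  choose r hr hrs h hh ht using
    fun (e : atlas ℂ M) (w : e.1.target) => g.exists_tendstoInChart U u h1 h2 e w.2
  -- The value at `w` is taken from the limit on the disc centred at `w`; uniqueness of limits then
  -- identifies `ψ e` with each local limit on its whole disc.
  let ψ : atlas ℂ M → ℂ → ℂ := fun e w => if hw : w ∈ e.1.target then h e ⟨w, hw⟩ w else 0
  have hψ : ∀ e (w : e.1.target), Set.EqOn (ψ e) (h e w) (Metric.ball w (r e w)) := by
    intro e w v hv
    have hv' := hrs e w hv
    simp only [ψ, dif_pos hv']
    exact g.tendstoInChart_unique Metric.isOpen_ball Metric.isOpen_ball (hrs e ⟨v, hv'⟩)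
      (hh e ⟨v, hv'⟩).continuousOn (hh e w).continuousOn (ht e ⟨v, hv'⟩) (ht e w)
      (Metric.mem_ball_self (hr e ⟨v, hv'⟩)) hv
  have hd : ∀ e, DifferentiableOn ℂ (ψ e) e.1.target := fun e w hw =>
    (((hh e ⟨w, hw⟩).congr (hψ e ⟨w, hw⟩)).differentiableAt (Metric.isOpen_ball.mem_nhds
      (Metric.mem_ball_self (hr e ⟨w, hw⟩)))).differentiableWithinAt
  let Φ : QuadDiff M := ⟨ψ, fun e => ((hd e).contDiffOn e.1.open_target).restrict_scalars ℝ,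
    fun e w hw => by simp [ψ, hw], fun e e' w hw hs => by
      have hw' := e'.1.map_source hs
      rw [show ψ e w = h e ⟨w, hw⟩ w by simp [ψ, hw],
        show ψ e' (e'.1 (e.1.symm w)) = h e' ⟨_, hw'⟩ (e'.1 (e.1.symm w)) by simp [ψ, hw']]
      exact g.tendstoInChart_transform Metric.isOpen_ball Metric.isOpen_ball (hrs e ⟨w, hw⟩)
        (hh e ⟨w, hw⟩).continuousOn (hh e' ⟨_, hw'⟩).continuousOn (ht e ⟨w, hw⟩) (ht e' ⟨_, hw'⟩)
        (Metric.mem_ball_self (hr e ⟨w, hw⟩)) hs (Metric.mem_ball_self (hr e' ⟨_, hw'⟩))⟩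
  refine ⟨Φ, hd, ?_⟩
  let W : M → Set M := fun x => (chartAt ℂ x).symm ''
    Metric.ball (chartAt ℂ x x) (r (preferredChart x) ⟨_, mem_chart_target ℂ x⟩)
  have hW : ∀ x, W x ∈ 𝓝 x := fun x =>
    ((chartAt ℂ x).symm.isOpen_image_of_subset_source Metric.isOpen_ball
      (hrs (preferredChart x) ⟨_, mem_chart_target ℂ x⟩)).mem_nhds
      ⟨_, Metric.mem_ball_self (hr _ _), (chartAt ℂ x).left_inv (mem_chart_source ℂ x)⟩
  -- Finitely many discs cover `M`, so convergence on each of them gives convergence of the global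
  -- norm.
  obtain ⟨t, -, ht'⟩ := isCompact_univ.elim_nhds_subcover W fun x _ => hW x
  refine tendsto_of_tendsto_of_tendsto_of_le_of_le (h := fun i => ∑ x ∈ t,
    ∫⁻ y in W x, ENNReal.ofReal (g.qdNorm (u i - Φ) y) ∂g.area)
    tendsto_const_nhds ?_ (fun i => zero_le) fun i => ?_
  · rw [← Finset.sum_const_zero (s := t)]
    refine tendsto_finsetSum _ fun x _ => ?_
    have hx : chartAt ℂ x x ∈ (preferredChart x).1.target := mem_chart_target ℂ x
    have heq : ∀ i, ∫⁻ y in W x, ENNReal.ofReal (g.qdNorm (u i - Φ) y) ∂g.area =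
        2 * ∫⁻ z in Metric.ball (chartAt ℂ x x) (r (preferredChart x) ⟨_, hx⟩),
          ‖(u i).1 (preferredChart x) z - h (preferredChart x) ⟨_, hx⟩ z‖ₑ := by
      intro i
      refine (g.setLIntegral_qdNorm (preferredChart x) Metric.isOpen_ball
        (hrs (preferredChart x) ⟨_, hx⟩) (u i - Φ)).trans ?_
      congr 1
      refine setLIntegral_congr_fun Metric.isOpen_ball.measurableSet fun z hz => ?_
      have := hψ (preferredChart x) ⟨_, hx⟩ hz
      simp only [AddSubgroupClass.coe_sub, Pi.sub_apply, Φ, this]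
    simp only [heq]
    simpa using ENNReal.Tendsto.const_mul (ht (preferredChart x) ⟨_, hx⟩)
      (Or.inr (ENNReal.ofNat_ne_top (n := 2)))
  · calc g.l1Norm (u i - Φ) = ∫⁻ y in ⋃ x ∈ t, W x, ENNReal.ofReal (g.qdNorm (u i - Φ) y) ∂g.area
      := by
          rw [Set.univ_subset_iff.mp ht', setLIntegral_univ, l1Norm]
      _ ≤ _ := setLIntegral_biUnion_finset_le _ _ _ _

/-! ### The Poincaré estimate on a compact flat surface -/

theorem l1Norm_smul (g : ConformalMetric M) (c : ℂ) (Ψ : QuadDiff M) :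
    g.l1Norm (c • Ψ) = ‖c‖ₑ * g.l1Norm Ψ := by
  simp only [l1Norm, qdNorm_smul, ENNReal.ofReal_mul (norm_nonneg _), ofReal_norm]
  exact lintegral_const_mul' _ _ enorm_ne_top

theorem l1NormDbar_smul (g : ConformalMetric M) (c : ℂ) (Ψ : QuadDiff M) :
    g.l1NormDbar (c • Ψ) = ‖c‖ₑ * g.l1NormDbar Ψ := by
  simp only [l1NormDbar, dbarNorm_smul, ENNReal.ofReal_mul (norm_nonneg _), ofReal_norm]
  exact lintegral_const_mul' _ _ enorm_ne_top

theorem l1Norm_lt_top [CompactSpace M] (g : ConformalMetric M) (h : g.area Set.univ = 1)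
    (Ψ : QuadDiff M) : g.l1Norm Ψ < ⊤ := by
  obtain ⟨B, hB⟩ := isCompact_univ.exists_bound_of_continuousOn (g.continuous_qdNorm Ψ).continuousOn
  calc g.l1Norm Ψ ≤ ∫⁻ x, ENNReal.ofReal B ∂g.area :=
        lintegral_mono fun x => ENNReal.ofReal_le_ofReal
          ((le_abs_self _).trans (hB x (Set.mem_univ x)))
    _ < ⊤ := by simp [h]

/-- A normalized sequence violating the estimate with constants `n` has an `L¹` limit that is both
holomorphic and orthogonal to the holomorphic differentials. -/
theorem IsFlat.exists_poincareEstimate [BorelSpace M] [SecondCountableTopology M] [CompactSpace M]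
    [PreconnectedSpace M] [Nonempty M] {g : ConformalMetric M} (hg : g.IsFlat)
    (h : g.area Set.univ = 1) : ∃ C : ℝ≥0, g.PoincareEstimate C := by
  by_contra! hcon
  have hseq : ∀ n : ℕ, ∃ u : QuadDiff M, g.l1Norm u = 1 ∧
      (∀ Θ : QuadDiff M, IsHolomorphicQD Θ → g.l2Inner u Θ = 0) ∧
      n * g.l1NormDbar u ≤ 1 := by
    intro n
    have hn := hcon n
    unfold PoincareEstimate at hn
    push Not at hn
    obtain ⟨Ψ, Φ, ⟨hΦ, hort⟩, hlt⟩ := hn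
    have hdb : g.l1NormDbar (Ψ - Φ) = g.l1NormDbar Ψ := by
      simp only [l1NormDbar, g.dbarNorm_sub_of_isHolomorphicQD Ψ hΦ]
    set v := Ψ - Φ
    have hN0 : g.l1Norm v ≠ 0 := (zero_le.trans_lt hlt).ne'
    have hNt := (g.l1Norm_lt_top h v).ne
    have hc : ‖(((g.l1Norm v).toReal⁻¹ : ℝ) : ℂ)‖ₑ = (g.l1Norm v)⁻¹ := by
      rw [← ofReal_norm, Complex.norm_real, Real.norm_eq_abs, abs_of_nonneg (by positivity),
        ENNReal.ofReal_inv_of_pos (ENNReal.toReal_pos hN0 hNt), ENNReal.ofReal_toReal hNt]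
    -- Removing the holomorphic part does not change `∂̄`, so `v = Ψ - Φ` can be scaled to norm one.
    refine ⟨(((g.l1Norm v).toReal⁻¹ : ℝ) : ℂ) • v, ?_, fun Θ hΘ => ?_, ?_⟩
    · rw [l1Norm_smul, hc, ENNReal.inv_mul_cancel hN0 hNt]
    · rw [l2Inner_smul_left, hort Θ hΘ, mul_zero]
    · rw [l1NormDbar_smul, hc, hdb, mul_left_comm, ← ENNReal.inv_mul_cancel hN0 hNt]
      gcongr
      exact_mod_cast hlt.le
  choose u hu1 hu2 hu3 using hseq
  have hlim : Tendsto (fun n => g.l1NormDbar (u n)) (hyperfilter ℕ) (𝓝 0) := by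
    refine Tendsto.mono_left ?_ Nat.hyperfilter_le_atTop
    refine tendsto_of_tendsto_of_tendsto_of_le_of_le tendsto_const_nhds
      ENNReal.tendsto_inv_nat_nhds_zero (fun n => zero_le) fun n => ?_
    rw [ENNReal.le_inv_iff_mul_le, mul_comm]
    exact hu3 n
  obtain ⟨Φ, hΦ, hlimΦ⟩ := g.exists_holomorphic_l1_limit (hyperfilter ℕ) u (fun n => (hu1 n).le)
    hlim
  obtain ⟨c, hc⟩ := hg.exists_qdNorm_eq_const hΦ
  have hΦ0 : g.l2Inner Φ Φ = 0 := by
    -- Orthogonality of `u n` to `Φ` gives `⟨Φ, Φ⟩ = -⟨u n - Φ, Φ⟩`. The norm of `Φ` is the constant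
    -- `c`, so `L¹` convergence is enough.
    have hb : ∀ n, ‖g.l2Inner Φ Φ‖ₑ ≤ ENNReal.ofReal c * g.l1Norm (u n - Φ) := by
      intro n
      have e : g.l2Inner Φ Φ = -g.l2Inner (u n - Φ) Φ := by
        rw [g.l2Inner_sub_left h, hu2 n Φ hΦ]
        ring
      rw [e, enorm_neg, l1Norm, ← lintegral_const_mul' _ _ ENNReal.ofReal_ne_top]
      refine (enorm_integral_le_lintegral_enorm _).trans (lintegral_mono fun x => ?_)
      rw [← ofReal_norm, norm_qdInner, hc x, mul_comm, ENNReal.ofReal_mul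
        (hc x ▸ g.qdNorm_nonneg Φ x)]
    have := ge_of_tendsto (ENNReal.Tendsto.const_mul hlimΦ
      (Or.inr (ENNReal.ofReal_ne_top (r := c)))) (Eventually.of_forall hb)
    simpa using this
  have hz := hg.eq_zero_of_l2Inner_self h hΦ hΦ0
  simp only [hz, sub_zero, hu1] at hlimΦ
  exact one_ne_zero (tendsto_nhds_unique tendsto_const_nhds hlimΦ)

end ConformalMetric

end RiemannSurface

/-! ### The period cell -/

/-- The linear coordinates `(s, t) ↦ s b + t (a + i / b)`. -/
noncomputable def latticeHomeo (a b : ℝ) (hb : b ≠ 0) : ℝ × ℝ ≃ₜ ℂ where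
  toFun p := p.1 * (b : ℂ) + p.2 * ((a : ℂ) + Complex.I / b)
  invFun z := (z.re / b - a * z.im, b * z.im)
  left_inv p := by
    have hc : (b : ℂ) ≠ 0 := by exact_mod_cast hb
    ext <;> simp [Complex.div_re, Complex.div_im, Complex.normSq_apply] <;> field_simp
    ring
  right_inv z := by
    apply Complex.ext <;> simp [Complex.div_re, Complex.div_im, Complex.normSq_apply] <;> field_simp
    ring
  continuous_toFun := by fun_prop
  continuous_invFun := by fun_prop

theorem latticeHomeo_apply (a b : ℝ) (hb : b ≠ 0) (p : ℝ × ℝ) :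
    latticeHomeo a b hb p = p.1 * (b : ℂ) + p.2 * ((a : ℂ) + Complex.I / b) := rfl

theorem latticeHomeo_sub (a b : ℝ) (hb : b ≠ 0) (p q : ℝ × ℝ) :
    latticeHomeo a b hb (p - q) = latticeHomeo a b hb p - latticeHomeo a b hb q := by
  simp only [latticeHomeo_apply, Prod.fst_sub, Prod.snd_sub]
  push_cast
  ring

/-- The matrix of the lattice basis is triangular with diagonal `b, b⁻¹`, so its determinant is one.
-/
theorem measurePreserving_latticeHomeo (a b : ℝ) (hb : b ≠ 0) :
    MeasurePreserving (latticeHomeo a b hb) := by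
  let T : ℝ × ℝ →ₗ[ℝ] ℝ × ℝ :=
    Matrix.toLin (Module.Basis.finTwoProd ℝ) (Module.Basis.finTwoProd ℝ) !![b, a; 0, b⁻¹]
  have hdet : LinearMap.det T = 1 := by
    simp [T, LinearMap.det_toLin, Matrix.det_fin_two_of, hb]
  have hT : MeasurePreserving T := by
    refine ⟨T.continuous_of_finiteDimensional.measurable, ?_⟩
    rw [Measure.map_linearMap_addHaar_eq_smul_addHaar _ (by simp [hdet]), hdet]
    simp
  have h := Complex.volume_preserving_equiv_real_prod.symm.comp hT
  convert h using 1
  ext1 p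
  have hp : T p = (b * p.1 + a * p.2, b⁻¹ * p.2) := by
    simp [T, Matrix.toLin_finTwoProd_apply]
  rw [Function.comp_apply, hp, Complex.measurableEquivRealProd_symm_apply]
  apply Complex.ext <;>
    simp [latticeHomeo_apply, Complex.div_re, Complex.div_im, Complex.normSq_apply] <;> field_simp

theorem torusCell_eq_image (a b : ℝ) (hb : b ≠ 0) :
    torusCell a b = latticeHomeo a b hb '' (Set.Ico 0 1 ×ˢ Set.Ico 0 1) := by
  ext w
  constructor
  · rintro ⟨s, hs, t, ht, rfl⟩
    exact ⟨(s, t), ⟨hs, ht⟩, rfl⟩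
  · rintro ⟨p, hp, rfl⟩
    exact ⟨p.1, hp.1, p.2, hp.2, rfl⟩

theorem mem_torusLattice_iff (a b : ℝ) (hb : b ≠ 0) (p : ℝ × ℝ) :
    latticeHomeo a b hb p ∈ torusLattice a b ↔ ∃ n m : ℤ, p = ((n : ℝ), (m : ℝ)) := by
  constructor
  · rintro ⟨n, m, h⟩
    refine ⟨n, m, (latticeHomeo a b hb).injective ?_⟩
    rw [h, latticeHomeo_apply]
    simp
  · rintro ⟨n, m, rfl⟩
    exact ⟨n, m, by simp [latticeHomeo_apply]⟩

theorem measurableSet_torusCell (a b : ℝ) (hb : b ≠ 0) : MeasurableSet (torusCell a b) := by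
  rw [torusCell_eq_image a b hb]
  exact (latticeHomeo a b hb).measurableEmbedding.measurableSet_image.mpr
    (measurableSet_Ico.prod measurableSet_Ico)

theorem setLIntegral_torusCell (a b : ℝ) (hb : b ≠ 0) (f : ℂ → ℝ≥0∞) :
    ∫⁻ z in torusCell a b, f z =
      ∫⁻ p in Set.Ico 0 1 ×ˢ Set.Ico 0 1, f (latticeHomeo a b hb p) := by
  rw [← (measurePreserving_latticeHomeo a b hb).setLIntegral_comp_preimage_emb
    (latticeHomeo a b hb).measurableEmbedding, torusCell_eq_image a b hb,
    Set.preimage_image_eq _ (latticeHomeo a b hb).injective]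

theorem setIntegral_torusCell (a b : ℝ) (hb : b ≠ 0) (f : ℂ → ℂ) :
    ∫ z in torusCell a b, f z =
      ∫ p in Set.Ico 0 1 ×ˢ Set.Ico 0 1, f (latticeHomeo a b hb p) := by
  rw [← (measurePreserving_latticeHomeo a b hb).setIntegral_preimage_emb
    (latticeHomeo a b hb).measurableEmbedding, torusCell_eq_image a b hb,
    Set.preimage_image_eq _ (latticeHomeo a b hb).injective]

theorem volume_torusCell (a b : ℝ) (hb : b ≠ 0) : volume (torusCell a b) = 1 := by
  have := setLIntegral_torusCell a b hb fun _ => 1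
  simp only [lintegral_const, one_mul, Measure.restrict_apply_univ] at this
  rw [this, Measure.volume_eq_prod, Measure.prod_prod]
  simp

theorem exists_mem_torusCell (a b : ℝ) (hb : b ≠ 0) (z : ℂ) :
    ∃ w ∈ torusCell a b, z - w ∈ torusLattice a b := by
  obtain ⟨p, rfl⟩ := (latticeHomeo a b hb).surjective z
  refine ⟨latticeHomeo a b hb (Int.fract p.1, Int.fract p.2), ?_, ?_⟩
  · rw [torusCell_eq_image a b hb]
    exact ⟨_, ⟨⟨Int.fract_nonneg _, Int.fract_lt_one _⟩, ⟨Int.fract_nonneg _, Int.fract_lt_one _⟩⟩,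
      rfl⟩
  · rw [← latticeHomeo_sub, mem_torusLattice_iff]
    exact ⟨⌊p.1⌋, ⌊p.2⌋, by ext <;> simp⟩

theorem eq_of_mem_torusCell (a b : ℝ) (hb : b ≠ 0) {z w : ℂ} (hz : z ∈ torusCell a b)
    (hw : w ∈ torusCell a b) (h : z - w ∈ torusLattice a b) : z = w := by
  rw [torusCell_eq_image a b hb] at hz hw
  obtain ⟨p, ⟨hp1, hp2⟩, rfl⟩ := hz
  obtain ⟨q, ⟨hq1, hq2⟩, rfl⟩ := hw
  rw [← latticeHomeo_sub, mem_torusLattice_iff] at h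
  obtain ⟨n, m, hnm⟩ := h
  have key : ∀ {x y : ℝ} {k : ℤ}, x ∈ Set.Ico (0 : ℝ) 1 → y ∈ Set.Ico (0 : ℝ) 1 → x - y = k →
      x = y := by
    intro x y k hx hy hk
    have h1 : (k : ℝ) < 1 := by linarith [hx.2, hy.1]
    have h2 : (-1 : ℝ) < k := by linarith [hx.1, hy.2]
    have h3 : k < 1 := by exact_mod_cast h1
    have h4 : -1 < k := by exact_mod_cast h2
    have h5 : k = 0 := by omega
    rw [h5, Int.cast_zero] at hk
    linarith
  congr 1
  exact Prod.ext (key hp1 hq1 (congrArg Prod.fst hnm)) (key hp2 hq2 (congrArg Prod.snd hnm))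

theorem exists_isCompact_torusCell_subset (a b : ℝ) (hb : b ≠ 0) :
    ∃ K : Set ℂ, IsCompact K ∧ torusCell a b ⊆ K := by
  refine ⟨latticeHomeo a b hb '' (Set.Icc 0 1 ×ˢ Set.Icc 0 1),
    (isCompact_Icc.prod isCompact_Icc).image (latticeHomeo a b hb).continuous, ?_⟩
  rw [torusCell_eq_image a b hb]
  exact Set.image_mono (Set.prod_mono Set.Ico_subset_Icc_self Set.Ico_subset_Icc_self)

theorem Continuous.integrableOn_torusCell {a b : ℝ} (hb : b ≠ 0) {φ : ℂ → ℂ} (hφ : Continuous φ) :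
    IntegrableOn φ (torusCell a b) := by
  obtain ⟨K, hK, hs⟩ := exists_isCompact_torusCell_subset a b hb
  exact (hφ.continuousOn.integrableOn_compact hK).mono_set hs

theorem average_torusCell {a b : ℝ} (hb : b ≠ 0) (φ : ℂ → ℂ) :
    ⨍ w in torusCell a b, φ w = ∫ w in torusCell a b, φ w := by
  rw [setAverage_eq, Measure.real, volume_torusCell a b hb]
  simp

/-- Liouville's theorem for a lattice of periods. -/
theorem exists_eq_const_of_periodic {a b : ℝ} (hb : b ≠ 0) {φ : ℂ → ℂ} (hφ : Differentiable ℂ φ)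
    (hp : ∀ z, ∀ w ∈ torusLattice a b, φ (z + w) = φ z) : ∃ c, ∀ z, φ z = c := by
  obtain ⟨K, hK, hs⟩ := exists_isCompact_torusCell_subset a b hb
  obtain ⟨B, hB⟩ := hK.exists_bound_of_continuousOn hφ.continuous.continuousOn
  refine ⟨φ 0, fun z => hφ.apply_eq_apply_of_bounded ?_ z 0⟩
  refine isBounded_iff_forall_norm_le.mpr ⟨B, ?_⟩
  rintro _ ⟨z, rfl⟩
  obtain ⟨w, hw, hzw⟩ := exists_mem_torusCell a b hb z
  have := hp w _ hzw
  rw [add_sub_cancel] at this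
  rw [this]
  exact hB w (hs hw)

namespace IsLatticePresentation

variable {M : Type*} [TopologicalSpace M] [ChartedSpace ℂ M] {g : ConformalMetric M} {a b : ℝ}
  {π : ℂ → M}

/-! ### The covering map in charts -/

theorem continuous (hπ : IsLatticePresentation g a b π) : Continuous π := hπ.holomorphic.continuous

theorem map_add (hπ : IsLatticePresentation g a b π) (z : ℂ) {w : ℂ} (hw : w ∈ torusLattice a b) :
    π (z + w) = π z := by
  rw [hπ.fiber, add_sub_cancel_left]
  exact hw

theorem deriv_ne_zero (hπ : IsLatticePresentation g a b π) (e : atlas ℂ M) {z : ℂ}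
    (hz : π z ∈ e.1.source) : deriv (e.1 ∘ π) z ≠ 0 := by
  intro h
  have := hπ.isometric e z hz
  rw [h, norm_zero, mul_zero] at this
  exact zero_ne_one this

theorem rho_eq (hπ : IsLatticePresentation g a b π) (e : atlas ℂ M) {z : ℂ}
    (hz : π z ∈ e.1.source) : g.rho e (e.1 (π z)) = ‖deriv (e.1 ∘ π) z‖⁻¹ :=
  eq_inv_of_mul_eq_one_left (hπ.isometric e z hz)

theorem isOpen_preimage (hπ : IsLatticePresentation g a b π) (e : atlas ℂ M) :
    IsOpen (π ⁻¹' e.1.source) := e.1.open_source.preimage hπ.continuous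

theorem differentiableAt (hπ : IsLatticePresentation g a b π) (e : atlas ℂ M) {z : ℂ}
    (hz : π z ∈ e.1.source) : DifferentiableAt ℂ (e.1 ∘ π) z :=
  differentiableAt_of_deriv_ne_zero (hπ.deriv_ne_zero e hz)

theorem differentiableOn (hπ : IsLatticePresentation g a b π) (e : atlas ℂ M) :
    DifferentiableOn ℂ (e.1 ∘ π) (π ⁻¹' e.1.source) :=
  fun _ hz => (hπ.differentiableAt e hz).differentiableWithinAt

theorem contDiffAt (hπ : IsLatticePresentation g a b π) (e : atlas ℂ M) {z : ℂ}
    (hz : π z ∈ e.1.source) (n : WithTop ℕ∞) : ContDiffAt ℂ n (e.1 ∘ π) z :=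
  ((hπ.differentiableOn e).contDiffOn (hπ.isOpen_preimage e)).contDiffAt
    ((hπ.isOpen_preimage e).mem_nhds hz)

theorem contDiffAt_deriv (hπ : IsLatticePresentation g a b π) (e : atlas ℂ M) {z : ℂ}
    (hz : π z ∈ e.1.source) (n : WithTop ℕ∞) : ContDiffAt ℂ n (deriv (e.1 ∘ π)) z :=
  (((hπ.differentiableOn e).deriv (hπ.isOpen_preimage e)).contDiffOn
    (hπ.isOpen_preimage e)).contDiffAt ((hπ.isOpen_preimage e).mem_nhds hz)

theorem deriv_add (hπ : IsLatticePresentation g a b π) (e : atlas ℂ M) (z : ℂ) {w : ℂ}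
    (hw : w ∈ torusLattice a b) : deriv (e.1 ∘ π) (z + w) = deriv (e.1 ∘ π) z := by
  rw [← deriv_comp_add_const]
  congr 1
  ext y
  simp [hπ.map_add y hw]

theorem deriv_eq_of_eq (hπ : IsLatticePresentation g a b π) (e : atlas ℂ M) {z y : ℂ}
    (h : π z = π y) : deriv (e.1 ∘ π) z = deriv (e.1 ∘ π) y := by
  have := hπ.deriv_add e y ((hπ.fiber z y).mp h)
  rwa [add_sub_cancel] at this

theorem deriv_chart_change (hπ : IsLatticePresentation g a b π) (e e' : atlas ℂ M) {z : ℂ}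
    (hz : π z ∈ e.1.source) (hz' : π z ∈ e'.1.source) :
    deriv (e'.1 ∘ π) z = deriv (e'.1 ∘ e.1.symm) (e.1 (π z)) * deriv (e.1 ∘ π) z := by
  have hev : e'.1 ∘ π =ᶠ[𝓝 z] (e'.1 ∘ e.1.symm) ∘ (e.1 ∘ π) := by
    filter_upwards [(hπ.isOpen_preimage e).mem_nhds hz] with y hy
    simp [e.1.left_inv hy]
  rw [hev.deriv_eq]
  exact deriv_comp z (g.differentiableAt_transition e e' (e.1.map_source hz)
    (by rwa [Function.comp_apply, e.1.left_inv hz])) (hπ.differentiableAt e hz)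

/-! ### The area measure -/

/-- The cell meets each fibre of `π` exactly once, and in a chart the Jacobian of `π` cancels `ρ²`
because `π` is isometric. -/
theorem area_eq [SecondCountableTopology M] [MeasurableSpace M] [BorelSpace M]
    (hπ : IsLatticePresentation g a b π) (hb : b ≠ 0) :
    g.area = (volume.restrict (torusCell a b)).map π := by
  have : Nonempty M := ⟨π 0⟩
  refine g.area_eq_of_chartArea_eq fun e A hA hs => ?_
  have hm : Measurable π := hπ.continuous.measurable
  rw [Measure.map_apply hm hA, Measure.restrict_apply (hm hA), g.chartArea_apply e hA]
  have himg : e.1.target ∩ e.1.symm ⁻¹' A = (e.1 ∘ π) '' (π ⁻¹' A ∩ torusCell a b) := by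
    ext w
    constructor
    · rintro ⟨hw, hwA⟩
      obtain ⟨z, hz⟩ := hπ.surjective (e.1.symm w)
      obtain ⟨y, hy, hzy⟩ := exists_mem_torusCell a b hb z
      have hyz : π y = e.1.symm w := by rw [← hz, eq_comm, hπ.fiber]; exact hzy
      refine ⟨y, ⟨?_, hy⟩, ?_⟩
      · rw [Set.mem_preimage, hyz]; exact hwA
      · rw [Function.comp_apply, hyz, e.1.right_inv hw]
    · rintro ⟨z, ⟨hzA, -⟩, rfl⟩
      refine ⟨e.1.map_source (hs hzA), ?_⟩
      simpa [e.1.left_inv (hs hzA)] using hzA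
  have hS : MeasurableSet (π ⁻¹' A ∩ torusCell a b) := (hm hA).inter
    (measurableSet_torusCell a b hb)
  rw [himg, lintegral_image_holomorphic hS (fun z hz => hπ.differentiableAt e (hs hz.1)),
    ← setLIntegral_one]
  · refine setLIntegral_congr_fun hS fun z hz => ?_
    have h1 := hπ.isometric e z (hs hz.1)
    simp only [Function.comp_apply]
    rw [← ENNReal.ofReal_mul (by positivity), ← mul_pow, mul_comm, h1]
    simp
  · rintro z ⟨hzA, hzc⟩ y ⟨hyA, hyc⟩ hzy
    exact eq_of_mem_torusCell a b hb hzc hyc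
      ((hπ.fiber z y).mp (e.1.injOn (hs hzA) (hs hyA) hzy))

/-! ### Pulling quadratic differentials back to the plane -/

end IsLatticePresentation

/-- The coefficient of the pull-back of a quadratic differential under `π : ℂ → M`. -/
noncomputable def qdPullback {M : Type*} [TopologicalSpace M] [ChartedSpace ℂ M] (π : ℂ → M)
    (Ψ : QuadDiff M) (z : ℂ) : ℂ :=
  Ψ.1 (preferredChart (π z)) (chartAt ℂ (π z) (π z)) * deriv (chartAt ℂ (π z) ∘ π) z ^ 2

namespace IsLatticePresentation

variable {M : Type*} [TopologicalSpace M] [ChartedSpace ℂ M] {g : ConformalMetric M} {a b : ℝ}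
  {π : ℂ → M}

theorem pullback_eq (hπ : IsLatticePresentation g a b π) (Ψ : QuadDiff M) (e : atlas ℂ M) {z : ℂ}
    (hz : π z ∈ e.1.source) :
    qdPullback π Ψ z = Ψ.1 e (e.1 (π z)) * deriv (e.1 ∘ π) z ^ 2 := by
  have hz' : π z ∈ (preferredChart (π z)).1.source := mem_chart_source ℂ _
  have h1 := Ψ.2.2.2 e (preferredChart (π z)) (e.1 (π z)) (e.1.map_source hz)
    (by rwa [e.1.left_inv hz])
  rw [e.1.left_inv hz] at h1
  rw [h1, mul_assoc, ← mul_pow, ← hπ.deriv_chart_change e (preferredChart (π z)) hz hz']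
  rfl

theorem pullback_eventuallyEq (hπ : IsLatticePresentation g a b π) (Ψ : QuadDiff M) (e : atlas ℂ M)
    {z : ℂ} (hz : π z ∈ e.1.source) :
    qdPullback π Ψ =ᶠ[𝓝 z] fun y => Ψ.1 e ((e.1 ∘ π) y) * deriv (e.1 ∘ π) y ^ 2 := by
  filter_upwards [(hπ.isOpen_preimage e).mem_nhds hz] with y hy using hπ.pullback_eq Ψ e hy

theorem isSmoothPeriodic_pullback (hπ : IsLatticePresentation g a b π) (Ψ : QuadDiff M) :
    IsSmoothPeriodic a b (qdPullback π Ψ) := by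
  constructor
  · rw [contDiff_iff_contDiffAt]
    intro z
    have hz : π z ∈ (preferredChart (π z)).1.source := mem_chart_source ℂ _
    refine ContDiffAt.congr_of_eventuallyEq ?_ (hπ.pullback_eventuallyEq Ψ _ hz)
    have h1 : ContDiffAt ℝ ∞ (Ψ.1 (preferredChart (π z)))
        (((preferredChart (π z)).1 ∘ π) z) :=
      ConformalMetric.qd_contDiffAt Ψ _ (mem_chart_target ℂ (π z))
    have h2 := (hπ.contDiffAt _ hz ∞).restrict_scalars ℝ
    have h3 := (hπ.contDiffAt_deriv _ hz ∞).restrict_scalars ℝ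
    exact (h1.comp z h2).mul (h3.pow 2)
  · intro z w hw
    have h1 : π (z + w) ∈ (preferredChart (π z)).1.source := by
      rw [hπ.map_add z hw]
      exact mem_chart_source ℂ _
    rw [hπ.pullback_eq Ψ _ h1, hπ.map_add z hw, hπ.deriv_add _ z hw]
    rfl

/-- Isometry gives `ρ = |(e ∘ π)'|⁻¹`, which cancels the derivatives in the pull-back and leaves the
Euclidean norm. -/
theorem qdNorm_eq (hπ : IsLatticePresentation g a b π) (Ψ : QuadDiff M) (z : ℂ) :
    g.qdNorm Ψ (π z) = 2 * ‖qdPullback π Ψ z‖ := by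
  have hz : π z ∈ (preferredChart (π z)).1.source := mem_chart_source ℂ _
  rw [hπ.pullback_eq Ψ _ hz, g.qdNorm_eq Ψ _ hz, hπ.rho_eq _ hz, norm_mul, norm_pow, inv_pow,
    inv_inv]
  ring

theorem dbarNorm_eq (hπ : IsLatticePresentation g a b π) (Ψ : QuadDiff M) (z : ℂ) :
    g.dbarNorm Ψ (π z) = 2 * Real.sqrt 2 * ‖dbarDeriv (qdPullback π Ψ) z‖ := by
  have hz : π z ∈ (preferredChart (π z)).1.source := mem_chart_source ℂ _
  have h := dbarDeriv_comp_mul (f := Ψ.1 (preferredChart (π z))) (F := (preferredChart (π z)).1 ∘ π)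
    (k := fun y => deriv ((preferredChart (π z)).1 ∘ π) y ^ 2) (z := z)
    (ConformalMetric.qd_differentiableAt Ψ _ (mem_chart_target ℂ (π z))) (hπ.differentiableAt _ hz)
    (((hπ.contDiffAt_deriv _ hz 1).differentiableAt (by simp)).pow 2)
  rw [(hπ.pullback_eventuallyEq Ψ _ hz).dbarDeriv_eq, h, g.dbarNorm_eq Ψ _ hz, hπ.rho_eq _ hz,
    norm_mul, norm_mul, RCLike.norm_conj, norm_pow, inv_pow, inv_inv, Function.comp_apply]
  ring

theorem qdInner_eq (hπ : IsLatticePresentation g a b π) (Φ Ψ : QuadDiff M) (z : ℂ) :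
    g.qdInner Φ Ψ (π z) = 4 * (qdPullback π Φ z * (starRingEnd ℂ) (qdPullback π Ψ z)) := by
  have hz : π z ∈ (preferredChart (π z)).1.source := mem_chart_source ℂ _
  rw [hπ.pullback_eq Ψ _ hz, hπ.pullback_eq Φ _ hz, g.qdInner_eq Φ Ψ _ hz, hπ.rho_eq _ hz, inv_pow,
    inv_inv]
  have hn : ((‖deriv ((preferredChart (π z)).1 ∘ π) z‖ ^ 4 : ℝ) : ℂ) =
      (deriv ((preferredChart (π z)).1 ∘ π) z *
        (starRingEnd ℂ) (deriv ((preferredChart (π z)).1 ∘ π) z)) ^ 2 := by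
    rw [Complex.mul_conj']
    push_cast
    ring
  rw [hn, map_mul, map_pow]
  ring

theorem differentiable_pullback (hπ : IsLatticePresentation g a b π) {Θ : QuadDiff M}
    (hΘ : IsHolomorphicQD Θ) : Differentiable ℂ (qdPullback π Θ) := by
  intro z
  have hz : π z ∈ (preferredChart (π z)).1.source := mem_chart_source ℂ _
  refine DifferentiableAt.congr_of_eventuallyEq ?_ (hπ.pullback_eventuallyEq Θ _ hz)
  have h1 : DifferentiableAt ℂ (Θ.1 (preferredChart (π z))) (((preferredChart (π z)).1 ∘ π) z) :=
    (hΘ _).differentiableAt ((preferredChart (π z)).1.open_target.mem_nhds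
      (mem_chart_target ℂ (π z)))
  exact (h1.comp z (hπ.differentiableAt _ hz)).mul
    (((hπ.contDiffAt_deriv _ hz 1).differentiableAt (by simp)).pow 2)

theorem pullback_eq_const (hπ : IsLatticePresentation g a b π) (hb : b ≠ 0) {Θ : QuadDiff M}
    (hΘ : IsHolomorphicQD Θ) : ∃ c, ∀ z, qdPullback π Θ z = c :=
  exists_eq_const_of_periodic hb (hπ.differentiable_pullback hΘ) (hπ.isSmoothPeriodic_pullback Θ).2

theorem pullback_sub (Ψ Φ : QuadDiff M) (z : ℂ) :
    qdPullback π (Ψ - Φ) z = qdPullback π Ψ z - qdPullback π Φ z := by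
  simp only [qdPullback, AddSubgroupClass.coe_sub, Pi.sub_apply]
  ring

/-! ### Norms in terms of the pull-back -/

section Norms

variable [SecondCountableTopology M] [MeasurableSpace M] [BorelSpace M]

theorem l1Norm_eq (hπ : IsLatticePresentation g a b π) (hb : b ≠ 0) (Ψ : QuadDiff M) :
    g.l1Norm Ψ = 2 * ∫⁻ z in torusCell a b, ‖qdPullback π Ψ z‖ₑ := by
  rw [ConformalMetric.l1Norm, hπ.area_eq hb,
    lintegral_map (g.continuous_qdNorm Ψ).measurable.ennreal_ofReal hπ.continuous.measurable,
    ← lintegral_const_mul' _ _ ENNReal.ofNat_ne_top]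
  congr 1 with z
  rw [hπ.qdNorm_eq, ENNReal.ofReal_mul zero_le_two, ofReal_norm, ENNReal.ofReal_ofNat]

theorem l1NormDbar_eq (hπ : IsLatticePresentation g a b π) (hb : b ≠ 0) (Ψ : QuadDiff M) :
    g.l1NormDbar Ψ = 2 * NNReal.sqrt 2 * ∫⁻ z in torusCell a b, ‖dbarDeriv (qdPullback π Ψ) z‖ₑ :=
      by
  rw [ConformalMetric.l1NormDbar, hπ.area_eq hb,
    lintegral_map (g.continuous_dbarNorm Ψ).measurable.ennreal_ofReal hπ.continuous.measurable,
    ← lintegral_const_mul' _ _ (ENNReal.mul_ne_top ENNReal.ofNat_ne_top ENNReal.coe_ne_top)]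
  congr 1 with z
  have h2 : ENNReal.ofReal (Real.sqrt 2) = NNReal.sqrt 2 := by
    rw [ENNReal.ofReal, Real.sqrt, Real.toNNReal_coe]
    simp
  rw [hπ.dbarNorm_eq, ENNReal.ofReal_mul (by positivity), ENNReal.ofReal_mul zero_le_two,
    ofReal_norm, ENNReal.ofReal_ofNat, h2]

theorem l2Inner_eq (hπ : IsLatticePresentation g a b π) (hb : b ≠ 0) (Φ Ψ : QuadDiff M) :
    g.l2Inner Φ Ψ =
      4 * ∫ z in torusCell a b, qdPullback π Φ z * (starRingEnd ℂ) (qdPullback π Ψ z) := by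
  rw [ConformalMetric.l2Inner, hπ.area_eq hb, integral_map hπ.continuous.aemeasurable
    (g.continuous_qdInner Φ Ψ).aestronglyMeasurable, ← integral_const_mul]
  simp only [hπ.qdInner_eq]

end Norms

/-! ### Descending periodic functions to quadratic differentials -/

/-- The inverse function theorem for `e ∘ π`. These local sections show that coefficients defined
through arbitrary preimages are smooth. -/
theorem exists_local_inverse (hπ : IsLatticePresentation g a b π) (e : atlas ℂ M) {z : ℂ}
    (hz : π z ∈ e.1.source) : ∃ G : ℂ → ℂ, ContDiffAt ℂ ∞ G (e.1 (π z)) ∧ G (e.1 (π z)) = z ∧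
      ∀ᶠ w in 𝓝 (e.1 (π z)), π (G w) ∈ e.1.source ∧ e.1 (π (G w)) = w := by
  have hd := (hπ.differentiableAt e hz).hasDerivAt.hasFDerivAt_equiv (hπ.deriv_ne_zero e hz)
  have hc := hπ.contDiffAt e hz ∞
  have hn : (∞ : WithTop ℕ∞) ≠ 0 := by simp
  have hG0 : hc.localInverse hd hn (e.1 (π z)) = z := hc.localInverse_apply_image hd hn
  have hG : ContDiffAt ℂ ∞ (hc.localInverse hd hn) (e.1 (π z)) := hc.to_localInverse hd hn
  refine ⟨hc.localInverse hd hn, hG, hG0, ?_⟩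
  have h1 : ∀ᶠ w in 𝓝 (e.1 (π z)), (e.1 ∘ π) (hc.localInverse hd hn w) = w :=
    (hc.hasStrictFDerivAt' hd hn).eventually_right_inverse
  have h2 : ∀ᶠ w in 𝓝 (e.1 (π z)), hc.localInverse hd hn w ∈ π ⁻¹' e.1.source := by
    refine hG.continuousAt.eventually ?_
    rw [hG0]
    exact (hπ.isOpen_preimage e).mem_nhds hz
  filter_upwards [h1, h2] with w hw1 hw2 using ⟨hw2, hw1⟩

open Classical in
/-- The coefficients on `M` of the quadratic differential with pull-back `φ dz²`. -/
noncomputable def descendFun (hπ : IsLatticePresentation g a b π) (φ : ℂ → ℂ) (e : atlas ℂ M)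
    (w : ℂ) : ℂ :=
  if w ∈ e.1.target then
    φ (Function.surjInv hπ.surjective (e.1.symm w)) /
      deriv (e.1 ∘ π) (Function.surjInv hπ.surjective (e.1.symm w)) ^ 2
  else 0

/-- The choice of preimage is immaterial, since `φ` and the derivative of `e ∘ π` are both periodic.
-/
theorem descendFun_apply (hπ : IsLatticePresentation g a b π) {φ : ℂ → ℂ}
    (hφ : ∀ z, ∀ w ∈ torusLattice a b, φ (z + w) = φ z) (e : atlas ℂ M) {z : ℂ}
    (hz : π z ∈ e.1.source) :
    hπ.descendFun φ e (e.1 (π z)) = φ z / deriv (e.1 ∘ π) z ^ 2 := by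
  rw [descendFun, if_pos (e.1.map_source hz), e.1.left_inv hz]
  have h := Function.surjInv_eq hπ.surjective (π z)
  have h1 := hφ z _ ((hπ.fiber _ z).mp h)
  rw [add_sub_cancel] at h1
  rw [h1, hπ.deriv_eq_of_eq e h]

theorem descendFun_eventuallyEq (hπ : IsLatticePresentation g a b π) {φ : ℂ → ℂ}
    (hφ : ∀ z, ∀ w ∈ torusLattice a b, φ (z + w) = φ z) (e : atlas ℂ M) {w : ℂ}
    (hw : w ∈ e.1.target) : ∃ G : ℂ → ℂ, ContDiffAt ℂ ∞ G w ∧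
      ContDiffAt ℂ ∞ (fun v => deriv (e.1 ∘ π) (G v) ^ 2) w ∧ deriv (e.1 ∘ π) (G w) ^ 2 ≠ 0 ∧
      hπ.descendFun φ e =ᶠ[𝓝 w] fun v => φ (G v) / deriv (e.1 ∘ π) (G v) ^ 2 := by
  obtain ⟨z, hz⟩ := hπ.surjective (e.1.symm w)
  have hzs : π z ∈ e.1.source := hz ▸ e.1.map_target hw
  have hzw : e.1 (π z) = w := by rw [hz, e.1.right_inv hw]
  obtain ⟨G, hG, hG0, hev⟩ := hπ.exists_local_inverse e hzs
  rw [hzw] at hG hG0 hev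
  refine ⟨G, hG, ?_, ?_, ?_⟩
  · have h := hπ.contDiffAt_deriv e hzs ∞
    rw [← hG0] at h
    exact (h.comp w hG).pow 2
  · rw [hG0]
    exact pow_ne_zero 2 (hπ.deriv_ne_zero e hzs)
  · filter_upwards [hev] with v hv
    rw [← hπ.descendFun_apply hφ e hv.1, hv.2]

/-- The quadratic differential on `M` with pull-back `φ dz²`. -/
noncomputable def descend (hπ : IsLatticePresentation g a b π) {φ : ℂ → ℂ}
    (hφ : IsSmoothPeriodic a b φ) : QuadDiff M :=
  ⟨hπ.descendFun φ, by
    refine ⟨fun e w hw => ?_, fun e w hw => if_neg hw, fun e e' w hw hs => ?_⟩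
    · obtain ⟨G, h1, h2, h3, h4⟩ := hπ.descendFun_eventuallyEq hφ.2 e hw
      refine ContDiffAt.contDiffWithinAt (ContDiffAt.congr_of_eventuallyEq ?_ h4)
      simp only [div_eq_mul_inv]
      exact (hφ.1.contDiffAt.comp w (h1.restrict_scalars ℝ)).mul ((h2.restrict_scalars ℝ).inv h3)
    · obtain ⟨z, hz⟩ := hπ.surjective (e.1.symm w)
      have hzs : π z ∈ e.1.source := hz ▸ e.1.map_target hw
      have hzs' : π z ∈ e'.1.source := hz ▸ hs
      have hzw : e.1 (π z) = w := by rw [hz, e.1.right_inv hw]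
      have h1 := hπ.deriv_chart_change e e' hzs hzs'
      have h2 := hπ.deriv_ne_zero e' hzs'
      have h3 := hπ.deriv_ne_zero e hzs
      rw [← hz, hπ.descendFun_apply hφ.2 e' hzs', ← hzw, hπ.descendFun_apply hφ.2 e hzs, h1]
      rw [h1] at h2
      have h4 := left_ne_zero_of_mul h2
      field_simp⟩

theorem pullback_descend (hπ : IsLatticePresentation g a b π) {φ : ℂ → ℂ}
    (hφ : IsSmoothPeriodic a b φ) : qdPullback π (hπ.descend hφ) = φ := by
  ext z
  have hz : π z ∈ (preferredChart (π z)).1.source := mem_chart_source ℂ _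
  rw [hπ.pullback_eq _ _ hz]
  have h := hπ.descendFun_apply hφ.2 _ hz
  have h3 := hπ.deriv_ne_zero _ hz
  rw [show (hπ.descend hφ).1 = hπ.descendFun φ from rfl, h, div_mul_cancel₀ _ (pow_ne_zero 2 h3)]

theorem _root_.isSmoothPeriodic_const (a b : ℝ) (c : ℂ) : IsSmoothPeriodic a b fun _ => c :=
  ⟨contDiff_const, fun _ _ _ => rfl⟩

theorem isHolomorphicQD_descend_const (hπ : IsLatticePresentation g a b π) (c : ℂ) :
    IsHolomorphicQD (hπ.descend (isSmoothPeriodic_const a b c)) := by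
  intro e w hw
  obtain ⟨G, h1, h2, h3, h4⟩ := hπ.descendFun_eventuallyEq (φ := fun _ => c)
    (isSmoothPeriodic_const a b c).2 e hw
  refine DifferentiableAt.differentiableWithinAt (DifferentiableAt.congr_of_eventuallyEq ?_ h4)
  exact (differentiableAt_const c).div (h2.differentiableAt (by simp)) h3

/-! ### The two estimates are equivalent -/

/-- Pull-back and descent match differentials with periodic functions, and holomorphic differentials
with constants. Orthogonality to constants on a cell of area one says that the holomorphic part is
the mean value. -/
theorem poincareEstimate_iff [SecondCountableTopology M] [MeasurableSpace M] [BorelSpace M]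
    (hπ : IsLatticePresentation g a b π) (hb : b ≠ 0) (C : ℝ≥0) :
    g.PoincareEstimate C ↔
      ∀ φ, IsSmoothPeriodic a b φ → LatticeBound a b φ (NNReal.sqrt 2 * C) := by
  have hcell : volume.real (torusCell a b) = 1 := by
    simp [Measure.real, volume_torusCell a b hb]
  have hsub : ∀ {φ : ℂ → ℂ} (_ : Continuous φ) (c : ℂ),
      ∫ z in torusCell a b, (φ z - c) = (∫ z in torusCell a b, φ z) - c := by
    intro φ hφ c
    rw [integral_sub (hφ.integrableOn_torusCell hb) (continuous_const.integrableOn_torusCell hb)]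
    simp [hcell]
  -- The norm factors `2` and `2√2` leave the ratio `√2`.
  have hscale : ∀ x y : ℝ≥0∞, 2 * x ≤ C * (2 * NNReal.sqrt 2 * y) ↔
      x ≤ (NNReal.sqrt 2 * C : ℝ≥0) * y := by
    intro x y
    have : (C : ℝ≥0∞) * (2 * NNReal.sqrt 2 * y) = 2 * ((NNReal.sqrt 2 * C : ℝ≥0) * y) := by
      push_cast
      ring
    rw [this]
    exact ENNReal.mul_le_mul_iff_right two_ne_zero ENNReal.ofNat_ne_top
  constructor
  · intro h φ hφ
    set c := ∫ z in torusCell a b, φ z with hc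
    have hpart : g.IsHolomorphicPart (hπ.descend hφ) (hπ.descend (isSmoothPeriodic_const a b c))
      := by
      refine ⟨hπ.isHolomorphicQD_descend_const c, fun Θ hΘ => ?_⟩
      obtain ⟨d, hd⟩ := hπ.pullback_eq_const hb hΘ
      rw [hπ.l2Inner_eq hb]
      simp only [pullback_sub, hπ.pullback_descend, hd]
      rw [integral_mul_const, hsub hφ.1.continuous, ← hc, sub_self, zero_mul, mul_zero]
    have h1 := h _ _ hpart
    rw [hπ.l1Norm_eq hb, hπ.l1NormDbar_eq hb, hscale] at h1
    simp only [pullback_sub, hπ.pullback_descend] at h1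
    rwa [LatticeBound, average_torusCell hb]
  · rintro h Ψ Φ ⟨hΦ, hort⟩
    obtain ⟨c, hc⟩ := hπ.pullback_eq_const hb hΦ
    have hsm := hπ.isSmoothPeriodic_pullback Ψ
    -- Testing orthogonality against the descent of `dz²` identifies `c` as the mean of the
    -- pull-back.
    have h1 := hort _ (hπ.isHolomorphicQD_descend_const 1)
    rw [hπ.l2Inner_eq hb] at h1
    simp only [pullback_sub, hπ.pullback_descend, hc, map_one, mul_one] at h1
    rw [hsub hsm.1.continuous] at h1
    have hcm : ∫ z in torusCell a b, qdPullback π Ψ z = c := by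
      rw [← sub_eq_zero]
      exact (mul_eq_zero.mp h1).resolve_left (by norm_num)
    have h2 := h _ hsm
    rw [LatticeBound, average_torusCell hb, hcm] at h2
    rw [hπ.l1Norm_eq hb, hπ.l1NormDbar_eq hb, hscale]
    simpa only [pullback_sub, hc] using h2

end IsLatticePresentation

/-! ### The flat torus `ℂ / Γ_{a,b}` as a Riemann surface -/

/-- The torus `ℂ / Γ_{a,b}`, in the coordinates `(s, t) ↦ s b + t (a + i / b)`. -/
def FlatTorus (_a _b : ℝ) : Type := AddCircle (1 : ℝ) × AddCircle (1 : ℝ)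

namespace FlatTorus

variable (a b : ℝ)

instance : TopologicalSpace (FlatTorus a b) :=
  inferInstanceAs (TopologicalSpace (AddCircle (1 : ℝ) × AddCircle (1 : ℝ)))

instance : MeasurableSpace (FlatTorus a b) := borel _

instance : BorelSpace (FlatTorus a b) := ⟨rfl⟩

/-- The torus is homeomorphic to the product of two circles. -/
noncomputable def homeoCircleProd : FlatTorus a b ≃ₜ Circle × Circle :=
  (AddCircle.homeomorphCircle one_ne_zero).prodCongr (AddCircle.homeomorphCircle one_ne_zero)

instance : SecondCountableTopology (FlatTorus a b) :=
  (homeoCircleProd a b).secondCountableTopology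

variable [hb : NeZero b]

/-- The projection `ℂ → ℂ / Γ_{a,b}`. -/
noncomputable def proj (z : ℂ) : FlatTorus a b :=
  ((((latticeHomeo a b hb.out).symm z).1 : AddCircle (1 : ℝ)),
    (((latticeHomeo a b hb.out).symm z).2 : AddCircle (1 : ℝ)))

theorem continuous_proj : Continuous (proj a b) := by
  have h := (latticeHomeo a b hb.out).symm.continuous
  exact ((AddCircle.continuous_mk' (1 : ℝ)).comp (continuous_fst.comp h)).prodMk
    ((AddCircle.continuous_mk' (1 : ℝ)).comp (continuous_snd.comp h))

theorem surjective_proj : Function.Surjective (proj a b) := by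
  rintro ⟨x, y⟩
  obtain ⟨s, rfl⟩ := QuotientAddGroup.mk_surjective x
  obtain ⟨t, rfl⟩ := QuotientAddGroup.mk_surjective y
  exact ⟨latticeHomeo a b hb.out (s, t), by simp [proj]; rfl⟩

theorem proj_eq_proj_iff (z w : ℂ) : proj a b z = proj a b w ↔ z - w ∈ torusLattice a b := by
  obtain ⟨p, rfl⟩ := (latticeHomeo a b hb.out).surjective z
  obtain ⟨q, rfl⟩ := (latticeHomeo a b hb.out).surjective w
  have key : ∀ x y : ℝ, (x : AddCircle (1 : ℝ)) = y ↔ ∃ n : ℤ, x - y = n := by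
    intro x y
    rw [← sub_eq_zero, ← AddCircle.coe_sub, AddCircle.coe_eq_zero_iff]
    simp [eq_comm]
  rw [← latticeHomeo_sub, mem_torusLattice_iff, proj, proj, Homeomorph.symm_apply_apply,
    Homeomorph.symm_apply_apply]
  constructor
  · intro h
    obtain ⟨n, hn⟩ := (key _ _).mp (congrArg Prod.fst h)
    obtain ⟨m, hm⟩ := (key _ _).mp (congrArg Prod.snd h)
    exact ⟨n, m, Prod.ext hn hm⟩
  · rintro ⟨n, m, h⟩
    exact Prod.ext ((key _ _).mpr ⟨n, congrArg Prod.fst h⟩)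
      ((key _ _).mpr ⟨m, congrArg Prod.snd h⟩)

/-- The chart of the torus which inverts the projection on an open period cell with corner `p`. -/
noncomputable def torusChart (p : ℝ × ℝ) : OpenPartialHomeomorph (FlatTorus a b) ℂ :=
  ((AddCircle.openPartialHomeomorphCoe (1 : ℝ) p.1).prod
    (AddCircle.openPartialHomeomorphCoe (1 : ℝ) p.2)).symm.trans
    (latticeHomeo a b hb.out).toOpenPartialHomeomorph

theorem torusChart_symm_apply (p : ℝ × ℝ) (w : ℂ) : (torusChart a b p).symm w = proj a b w := rfl

theorem exists_mem_torusChart_source (x : FlatTorus a b) : ∃ p, x ∈ (torusChart a b p).source := by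
  obtain ⟨z, rfl⟩ := surjective_proj a b x
  set q := (latticeHomeo a b hb.out).symm z with hq
  -- This corner puts `q` at the centre of the open unit cell.
  refine ⟨(q.1 - 1 / 2, q.2 - 1 / 2), ?_⟩
  rw [← torusChart_symm_apply a b (q.1 - 1 / 2, q.2 - 1 / 2)]
  apply OpenPartialHomeomorph.map_target
  have : q ∈ Set.Ioo (q.1 - 1 / 2) (q.1 - 1 / 2 + 1) ×ˢ Set.Ioo (q.2 - 1 / 2) (q.2 - 1 / 2 + 1) :=
    by
    constructor <;> constructor <;> linarith
  simpa [torusChart, ← hq] using this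

noncomputable instance : ChartedSpace ℂ (FlatTorus a b) where
  atlas := Set.range (torusChart a b)
  chartAt x := torusChart a b (exists_mem_torusChart_source a b x).choose
  mem_chart_source x := (exists_mem_torusChart_source a b x).choose_spec
  chart_mem_atlas _ := ⟨_, rfl⟩

theorem atlas_symm_apply (e : atlas ℂ (FlatTorus a b)) (w : ℂ) : e.1.symm w = proj a b w := by
  obtain ⟨_, p, rfl⟩ := e
  rfl

/-- In the charts of the torus the projection is locally a translation. -/
theorem chart_comp_proj_eventuallyEq (e : atlas ℂ (FlatTorus a b)) {z : ℂ}
    (hz : proj a b z ∈ e.1.source) :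
    e.1 ∘ proj a b =ᶠ[𝓝 z] fun y => y + (e.1 (proj a b z) - z) := by
  set w := e.1 (proj a b z) with hw
  have hwt : w ∈ e.1.target := e.1.map_source hz
  have hwz : proj a b w = proj a b z := by rw [← atlas_symm_apply a b e, hw, e.1.left_inv hz]
  have hlat := (proj_eq_proj_iff a b w z).mp hwz
  have hcont : Tendsto (fun y => y + (w - z)) (𝓝 z) (𝓝 w) := by
    have : Continuous fun y : ℂ => y + (w - z) := by fun_prop
    simpa using this.tendsto z
  filter_upwards [hcont.eventually (e.1.open_target.mem_nhds hwt)] with y hy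
  have h1 : proj a b (y + (w - z)) = proj a b y := by
    rw [proj_eq_proj_iff, add_sub_cancel_left]
    exact hlat
  rw [Function.comp_apply, ← h1, ← atlas_symm_apply a b e, e.1.right_inv hy]

/-- All inverse charts are the same projection, so a transition map is a chart after the projection,
locally a translation. -/
theorem transition_eventuallyEq (e e' : atlas ℂ (FlatTorus a b)) {w : ℂ}
    (hs : e.1.symm w ∈ e'.1.source) :
    e'.1 ∘ e.1.symm =ᶠ[𝓝 w] fun y => y + (e'.1 (proj a b w) - w) := by
  have h : (e.1.symm : ℂ → FlatTorus a b) = proj a b := funext (atlas_symm_apply a b e)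
  rw [h] at hs ⊢
  exact chart_comp_proj_eventuallyEq a b e' hs

instance : IsManifold 𝓘(ℂ) ω (FlatTorus a b) := by
  refine isManifold_of_contDiffOn 𝓘(ℂ) ω (FlatTorus a b) fun e e' he he' => ?_
  rintro w hw
  have hs : e.symm w ∈ e'.source := by
    have := hw.1
    simp only [OpenPartialHomeomorph.trans_source, Set.mem_preimage] at this
    exact this.2
  have h := transition_eventuallyEq a b ⟨e, he⟩ ⟨e', he'⟩ hs
  refine ContDiffAt.contDiffWithinAt (ContDiffAt.congr_of_eventuallyEq ?_ h)
  exact contDiffAt_id.add contDiffAt_const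

/-- The Euclidean metric on the torus. -/
noncomputable def euclideanMetric : ConformalMetric (FlatTorus a b) where
  rho _ _ := 1
  smooth _ := contDiffOn_const
  pos _ _ _ := one_pos
  transform e e' w _ hs := by
    rw [(transition_eventuallyEq a b e e' hs).deriv_eq]
    simp

theorem isLatticePresentation : IsLatticePresentation (euclideanMetric a b) a b (proj a b) where
  surjective := surjective_proj a b
  fiber := proj_eq_proj_iff a b
  holomorphic z := by
    rw [mdifferentiableAt_iff]
    refine ⟨(continuous_proj a b).continuousAt, ?_⟩
    have h := chart_comp_proj_eventuallyEq a b (preferredChart (proj a b z)) (mem_chart_source ℂ _)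
    refine DifferentiableAt.differentiableWithinAt (DifferentiableAt.congr_of_eventuallyEq ?_ h)
    exact differentiableAt_id.add_const _
  isometric e z hz := by
    rw [(chart_comp_proj_eventuallyEq a b e hz).deriv_eq]
    simp [euclideanMetric]

theorem isFlatUnitTorus : (euclideanMetric a b).IsFlatUnitTorus where
  torus := ⟨homeoCircleProd a b⟩
  flat e w _ := by
    have : (fun v => Real.log ((euclideanMetric a b).rho e v)) = fun _ => (0 : ℝ) := by
      simp [euclideanMetric]
    rw [ConformalMetric.gaussCurvature, this]
    simp
  unit_area := by
    rw [(isLatticePresentation a b).area_eq hb.out,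
      Measure.map_apply (continuous_proj a b).measurable MeasurableSet.univ]
    simp [volume_torusCell a b hb.out]

end FlatTorus

/-! ### The estimate on flat unit-area tori -/

theorem ConformalMetric.IsFlatUnitTorus.projection_and_estimate {M : Type*} [TopologicalSpace M]
    [ChartedSpace ℂ M] [MeasurableSpace M] [BorelSpace M] {g : ConformalMetric M}
    (hg : g.IsFlatUnitTorus) :
    (∀ Ψ : QuadDiff M, ∃! Φ : QuadDiff M, g.IsHolomorphicPart Ψ Φ) ∧
      ∃ C : ℝ≥0, g.PoincareEstimate C := by
  obtain ⟨f⟩ := hg.torus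
  have : SecondCountableTopology M := f.secondCountableTopology
  have : CompactSpace M := f.symm.compactSpace
  have : PreconnectedSpace M := (Function.Surjective.connectedSpace f.symm.surjective
    f.symm.continuous).toPreconnectedSpace
  have : Nonempty M := f.toEquiv.nonempty
  exact ⟨hg.flat.existsUnique_isHolomorphicPart hg.unit_area,
    hg.flat.exists_poincareEstimate hg.unit_area⟩

/-- Read off from the compactness estimate on the explicit torus `FlatTorus a b`. -/
theorem exists_latticeBound (a : ℝ) {b : ℝ} (hb : 0 < b) :
    ∃ C : ℝ≥0, ∀ φ, IsSmoothPeriodic a b φ → LatticeBound a b φ C := by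
  have : NeZero b := ⟨hb.ne'⟩
  obtain ⟨-, C, hC⟩ := (FlatTorus.isFlatUnitTorus a b).projection_and_estimate
  exact ⟨_, ((FlatTorus.isLatticePresentation a b).poincareEstimate_iff hb.ne' C).mp hC⟩

/-! ### Long thin tori -/

/-- The function `sin (2πx / b)`. -/
noncomputable def sineWave (b : ℝ) (z : ℂ) : ℂ := (Real.sin (2 * Real.pi / b * z.re) : ℂ)

theorem isSmoothPeriodic_sineWave {b : ℝ} (hb : b ≠ 0) : IsSmoothPeriodic 0 b (sineWave b) := by
  constructor
  · have h : ContDiff ℝ ∞ fun z : ℂ => Real.sin (2 * Real.pi / b * z.re) :=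
      Real.contDiff_sin.comp (contDiff_const.mul Complex.reCLM.contDiff)
    exact Complex.ofRealCLM.contDiff.comp h
  · rintro z w ⟨n, m, rfl⟩
    have : 2 * Real.pi / b * (z + (n * (b : ℂ) + m * (((0 : ℝ) : ℂ) + Complex.I / b))).re =
        2 * Real.pi / b * z.re + n * (2 * Real.pi) := by
      simp [Complex.div_re]
      field_simp
    rw [sineWave, this, Real.sin_add_int_mul_two_pi, sineWave]

/-- There is no `y`-dependence, so `∂̄` is half the `x`-derivative, that is `(π/b) cos (2πx/b)`. -/
theorem enorm_dbarDeriv_sineWave_le {b : ℝ} (hb : 0 < b) (z : ℂ) :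
    ‖dbarDeriv (sineWave b) z‖ₑ ≤ ENNReal.ofReal (Real.pi / b) := by
  have h1 : HasFDerivAt (fun z : ℂ => Real.sin (2 * Real.pi / b * z.re))
      (Real.cos (2 * Real.pi / b * z.re) • ((2 * Real.pi / b) • Complex.reCLM)) z :=
    (Complex.reCLM.hasFDerivAt.const_mul (2 * Real.pi / b)).sin
  have h2 : HasFDerivAt (sineWave b) _ z := Complex.ofRealCLM.hasFDerivAt.comp z h1
  apply enorm_le_ofReal
  rw [dbarDeriv, h2.fderiv]
  have : (1 / 2 : ℂ) * ((Complex.ofRealCLM.comp (Real.cos (2 * Real.pi / b * z.re) •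
      ((2 * Real.pi / b) • Complex.reCLM))) 1 + Complex.I * (Complex.ofRealCLM.comp
      (Real.cos (2 * Real.pi / b * z.re) • ((2 * Real.pi / b) • Complex.reCLM))) Complex.I) =
      ((Real.cos (2 * Real.pi / b * z.re) * (Real.pi / b) : ℝ) : ℂ) := by
    simp
    ring
  rw [this, Complex.norm_real, norm_mul, Real.norm_eq_abs, Real.norm_eq_abs,
    abs_of_pos (div_pos Real.pi_pos hb)]
  exact mul_le_of_le_one_left (by positivity) (Real.abs_cos_le_one _)

theorem sineWave_latticeHomeo {b : ℝ} (hb : b ≠ 0) (p : ℝ × ℝ) :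
    sineWave b (latticeHomeo 0 b hb p) = (Real.sin (2 * Real.pi * p.1) : ℂ) := by
  have : 2 * Real.pi / b * (latticeHomeo 0 b hb p).re = 2 * Real.pi * p.1 := by
    simp [latticeHomeo_apply, Complex.div_re]
    field_simp
  rw [sineWave, this]

theorem integral_sin_two_pi : ∫ s in Set.Ico (0 : ℝ) 1, (Real.sin (2 * Real.pi * s) : ℂ) = 0 := by
  rw [integral_complex_ofReal, integral_Ico_eq_integral_Ioc,
    ← intervalIntegral.integral_of_le zero_le_one,
    intervalIntegral.integral_comp_mul_left (fun x => Real.sin x) (by positivity)]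
  simp

theorem integral_sineWave {b : ℝ} (hb : b ≠ 0) : ∫ z in torusCell 0 b, sineWave b z = 0 := by
  rw [setIntegral_torusCell 0 b hb]
  simp only [sineWave_latticeHomeo]
  rw [Measure.volume_eq_prod, setIntegral_prod]
  · simp only [setIntegral_const]
    rw [integral_smul, integral_sin_two_pi, smul_zero]
  · have hc : Continuous fun p : ℝ × ℝ => (Real.sin (2 * Real.pi * p.1) : ℂ) := by fun_prop
    exact (hc.continuousOn.integrableOn_compact ((isCompact_Icc (a := (0 : ℝ)) (b := 1)).prod
      (isCompact_Icc (a := (0 : ℝ)) (b := 1)))).mono_set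
      (Set.prod_mono Set.Ico_subset_Icc_self Set.Ico_subset_Icc_self)

/-- From `|sin| ≤ 1` follows `|sin| ≥ sin²`, whose mean over a period is `1/2`. -/
theorem half_le_lintegral_sineWave {b : ℝ} (hb : b ≠ 0) :
    ENNReal.ofReal (1 / 2) ≤ ∫⁻ z in torusCell 0 b, ‖sineWave b z‖ₑ := by
  have h1 : ∫ s in Set.Ico (0 : ℝ) 1, Real.sin (2 * Real.pi * s) ^ 2 = 1 / 2 := by
    rw [integral_Ico_eq_integral_Ioc, ← intervalIntegral.integral_of_le zero_le_one,
      intervalIntegral.integral_comp_mul_left (fun x => Real.sin x ^ 2) (by positivity),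
      integral_sin_sq]
    simp
    field_simp
  have h2 : IntegrableOn (fun s : ℝ => Real.sin (2 * Real.pi * s) ^ 2) (Set.Ico 0 1) :=
    ((by fun_prop : Continuous fun s : ℝ => Real.sin (2 * Real.pi * s) ^ 2).continuousOn
      |>.integrableOn_compact (isCompact_Icc (a := (0 : ℝ)) (b := 1))).mono_set
      Set.Ico_subset_Icc_self
  have hm : Measurable fun p : ℝ × ℝ => ENNReal.ofReal (Real.sin (2 * Real.pi * p.1) ^ 2) := by
    fun_prop
  calc ENNReal.ofReal (1 / 2)
      = ∫⁻ s in Set.Ico (0 : ℝ) 1, ENNReal.ofReal (Real.sin (2 * Real.pi * s) ^ 2) := by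
        rw [← h1, ofReal_integral_eq_lintegral_ofReal h2
          (Eventually.of_forall fun s => sq_nonneg _)]
    _ = ∫⁻ p in Set.Ico (0 : ℝ) 1 ×ˢ Set.Ico (0 : ℝ) 1,
          ENNReal.ofReal (Real.sin (2 * Real.pi * p.1) ^ 2) := by
        rw [Measure.volume_eq_prod, ← Measure.prod_restrict,
          lintegral_prod _ hm.aemeasurable]
        simp
    _ ≤ _ := by
        rw [setLIntegral_torusCell 0 b hb]
        refine lintegral_mono fun p => ?_
        rw [sineWave_latticeHomeo, ← ofReal_norm, Complex.norm_real, Real.norm_eq_abs]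
        apply ENNReal.ofReal_le_ofReal
        rw [← sq_abs]
        have := Real.abs_sin_le_one (2 * Real.pi * p.1)
        nlinarith [abs_nonneg (Real.sin (2 * Real.pi * p.1))]

theorem eventually_not_latticeBound_sineWave (C : ℝ≥0) :
    ∀ᶠ b : ℝ in atTop, 0 < b ∧ ¬ LatticeBound 0 b (sineWave b) C := by
  -- Beyond this threshold `C * (π/b) < 1/2`.
  filter_upwards [eventually_gt_atTop (0 : ℝ), eventually_gt_atTop (2 * C * Real.pi)] with b hb hbC
  refine ⟨hb, fun h => ?_⟩
  rw [LatticeBound, average_torusCell hb.ne', integral_sineWave hb.ne'] at h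
  simp only [sub_zero] at h
  have h1 : ∫⁻ z in torusCell 0 b, ‖dbarDeriv (sineWave b) z‖ₑ ≤ ENNReal.ofReal (Real.pi / b) := by
    calc _ ≤ ∫⁻ z in torusCell 0 b, ENNReal.ofReal (Real.pi / b) :=
          lintegral_mono fun z => enorm_dbarDeriv_sineWave_le hb z
      _ = _ := by simp [volume_torusCell 0 b hb.ne']
  have h2 : ENNReal.ofReal (1 / 2) ≤ ENNReal.ofReal (C * (Real.pi / b)) := by
    rw [ENNReal.ofReal_mul C.coe_nonneg, ENNReal.ofReal_coe_nnreal]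
    exact (half_le_lintegral_sineWave hb.ne').trans (h.trans (by gcongr))
  rw [ENNReal.ofReal_le_ofReal_iff (by positivity), ← mul_div_assoc, le_div_iff₀ hb] at h2
  linarith

theorem exists_flatTorus_not_poincareEstimate (C : ℝ≥0) :
    ∃ (M : Type) (_ : TopologicalSpace M) (_ : ChartedSpace ℂ M) (_ : IsManifold 𝓘(ℂ) ω M)
      (_ : MeasurableSpace M) (_ : BorelSpace M) (g : ConformalMetric M),
      g.IsFlatUnitTorus ∧ ¬ g.PoincareEstimate C := by
  -- The constant `√2 C` is the one that corresponds to `C` on the torus.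
  obtain ⟨b, hb, hnot⟩ := (eventually_not_latticeBound_sineWave (NNReal.sqrt 2 * C)).exists
  have : NeZero b := ⟨hb.ne'⟩
  refine ⟨FlatTorus 0 b, inferInstance, inferInstance, inferInstance, inferInstance, inferInstance,
    FlatTorus.euclideanMetric 0 b, FlatTorus.isFlatUnitTorus 0 b, fun h => hnot ?_⟩
  exact ((FlatTorus.isLatticePresentation 0 b).poincareEstimate_iff hb.ne' C).mp h _
    (isSmoothPeriodic_sineWave hb.ne')

theorem mainTheorem7 :
    -- on each flat unit-area torus, `P_g` is well defined and the estimate holds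
    (∀ (M : Type*) [TopologicalSpace M] [ChartedSpace ℂ M] [IsManifold 𝓘(ℂ) ω M]
        [MeasurableSpace M] [BorelSpace M] (g : ConformalMetric M), g.IsFlatUnitTorus →
      (∀ Ψ : QuadDiff M, ∃! Φ : QuadDiff M, g.IsHolomorphicPart Ψ Φ) ∧
      ∃ C : ℝ≥0, g.PoincareEstimate C) ∧
    -- no constant serves all flat unit-area tori
    (∀ C : ℝ≥0, ∃ (M : Type) (_ : TopologicalSpace M) (_ : ChartedSpace ℂ M)
        (_ : IsManifold 𝓘(ℂ) ω M) (_ : MeasurableSpace M) (_ : BorelSpace M)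
        (g : ConformalMetric M), g.IsFlatUnitTorus ∧ ¬ g.PoincareEstimate C) ∧
    -- on a torus isometric to `ℂ / Γ_{a,b}` the estimate amounts to one for periodic functions
    (∀ (M : Type*) [TopologicalSpace M] [ChartedSpace ℂ M] [IsManifold 𝓘(ℂ) ω M]
        [MeasurableSpace M] [BorelSpace M] (g : ConformalMetric M), g.IsFlatUnitTorus →
      ∀ (a b : ℝ) (π : ℂ → M), 0 < b → IsLatticePresentation g a b π → ∀ C : ℝ≥0,
        (g.PoincareEstimate C ↔
          ∀ φ, IsSmoothPeriodic a b φ → LatticeBound a b φ (NNReal.sqrt 2 * C))) ∧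
    -- the estimate for periodic functions holds for each lattice
    (∀ a b : ℝ, 0 < b → ∃ C : ℝ≥0, ∀ φ, IsSmoothPeriodic a b φ → LatticeBound a b φ C) ∧
    -- the example `sin (2πx/b)` on `ℂ / Γ_{0,b}` with `b → ∞`
    (∀ C : ℝ≥0, ∀ᶠ b : ℝ in atTop,
      IsSmoothPeriodic 0 b (fun z => (Real.sin (2 * Real.pi / b * z.re) : ℂ)) ∧
      ¬ LatticeBound 0 b (fun z => (Real.sin (2 * Real.pi / b * z.re) : ℂ)) C) := by
  refine ⟨fun M _ _ _ _ _ g hg => hg.projection_and_estimate,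
    exists_flatTorus_not_poincareEstimate, fun M _ _ _ _ _ g hg a b π hb hπ C => ?_,
    fun a b hb => exists_latticeBound a hb, fun C => ?_⟩
  · obtain ⟨f⟩ := hg.torus
    have : SecondCountableTopology M := f.secondCountableTopology
    exact hπ.poincareEstimate_iff hb.ne' C
  · filter_upwards [eventually_not_latticeBound_sineWave C] with b hb
    exact ⟨isSmoothPeriodic_sineWave hb.1.ne', hb.2⟩
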